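/- **Model.** A program runs on a random access machine with a fixed number of classical word variables and arrays and a fixed number of quantum words. One step is one elementary instruction: an assignment or array access with an expression of constant size, one evaluated branch or loop test, one classical query to the black box, one quantum gate, or one measurement of a quantum word. The quantum gates are: Hadamard gates on all of the $k$ lowest bits of a word, XOR of a classical value into a quantum word, a black-box query $|i\rangle|z\rangle\mapsto|i\rangle|z\oplus \mathrm{entry}(v,i)\rangle$, a quantum read $|i\rangle|z\rangle\mapsto|i\rangle|z\oplus A[i]\rangle$ of a classical array $A$, and the sign flip of the basis states that satisfy finitely many equalities of words. The input is a directed graph $G=(V,E)$ without loops, $|V|=n$, with at least one edge, whose underlying undirected graph is connected, and a starting vertex $a\in V$. It is given by a black box. * Adjacency model: the entries of the matrix $A[v,w]\in\{0,1\}$ with $A[v,w]=1$ iff $(v,w)\in E$. * List model: arrays $N_v$ of length $d_v\le n$ ($d_v$ can be queried), each entry a vertex or a hole, such that the vertices occurring in $N_v$ are exactly the $w$ with $(v,w)\in E$. **Layers.** The layer numbers are $\ell:V\to\mathbb N\cup\{\infty\}$ with $\ell(a)=0$ and $\ell(y)=1+\min_{x:(x,y)\in E}\ell(x)$ for $y\neq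 a$ (with $\min\emptyset=\infty$). **Algorithm.** Quantum breadth-first search sets $\ell(a)=0$ and $\ell(x)=\infty$ for $x\ne a$, and creates the queue $W=\{a\}$. While $W\neq\emptyset$, it takes the first vertex $x$ of $W$, finds the neighbours $y$ of $x$ with $\ell(y)=\infty$ one after the other by Grover's search until a search finds none, sets $\ell(y):=\ell(x)+1$ and appends $y$ to $W$ for each of them, and removes $x$ from $W$. A Grover search is over $2^k$ indices, where $k$ is minimal with $2^k$ at least the length of the row or list of $x$. For $s=0,1,2,\dots$ with $2s\le k+2$ it makes up to $c\,(1+\lceil\log_2 n\rceil)$ runs of Grover's algorithm with a number of iterations drawn uniformly from $\{0,\dots,2^s-1\}$, checks each measured index, and stops at the first success. **Theorem.** There are constants $c\in\mathbb N$ and $C>0$ such that for all such inputs the following holds. * In the adjacency model, with probability at least $1-\frac1n$, the algorithm halts within $C\,n^{3/2}\log n$ steps with the correct layer numbers of all vertices. * In the list model, with probability at least $1-\frac1n$, the algorithm halts within $C\sqrt{n\,L}\,\log n$ steps with the correct layer numbers of all vertices, where $L=\sum_v d_v$. In particular, if $L$ equals the number $m$ of edges (every edge listed once, no holes), this happens within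 $C\sqrt{nm}\,\log n$ steps. -/

import Mathlib

/-! A classical random access machine with a constant number of quantum words and a black box that
holds the input graph; one machine step per instruction; quantum breadth-first search as a program
of this machine. -/

namespace QBFS

/-! ### Machine words and classical expressions -/

/-- Classical word variables of the machine. -/
inductive Var
  | size | src | head | tail | cur | y | z | deg | bits | dim | reps | rep | stage | iter | i | found
  deriving DecidableEq

/-- Classical arrays: the layer numbers and the queue. -/
inductive Arr
  | lay | queue
  deriving DecidableEq

/-- Quantum words. -/
inductive QReg
  | idx | out | lab
  deriving DecidableEq

/-- The classical memory: word variables and arrays of words. -/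
structure Mem where
  vars : Var → ℕ
  arrs : Arr → ℕ → ℕ

/-- Arithmetic expressions (those of a fixed program have constant size). -/
inductive Arith
  | lit (k : ℕ)
  | var (x : Var)
  | plus (e f : Arith)
  | minus (e f : Arith)
  | get (A : Arr) (e : Arith)

def Arith.eval (μ : Mem) : Arith → ℕ
  | lit k => k
  | var x => μ.vars x
  | plus e f => e.eval μ + f.eval μ
  | minus e f => e.eval μ - f.eval μ
  | get A e => μ.arrs A (e.eval μ)

/-- Tests for branches and loops. -/
inductive Test
  | eq (e f : Arith)
  | lt (e f : Arith)
  | both (s t : Test)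

def Test.holds (μ : Mem) : Test → Prop
  | eq e f => e.eval μ = f.eval μ
  | lt e f => e.eval μ < f.eval μ
  | both s t => s.holds μ ∧ t.holds μ

def Mem.setVar (μ : Mem) (x : Var) (k : ℕ) : Mem :=
  { μ with vars := Function.update μ.vars x k }

def Mem.setArr (μ : Mem) (A : Arr) (j k : ℕ) : Mem :=
  { μ with arrs := Function.update μ.arrs A (Function.update (μ.arrs A) j k) }

/-- The black box containing the input: `entry v j` is the `j`-th entry (counted from `0`) of the
row or list of vertex `v`, and `len v` is the length of the list of `v`. -/
structure BlackBox where
  len : ℕ → ℕ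
  entry : ℕ → ℕ → ℕ

/-! ### The quantum words -/

/-- A computational basis state assigns a number to every quantum word. -/
abbrev Basis := QReg → ℕ

/-- Quantum states, as finite superpositions of basis states. They are not normalized: the squared
norm of the state on a branch of the computation is the probability of that branch. -/
abbrev QState := Basis →₀ ℂ

noncomputable def QState.normSq (ψ : QState) : ℝ := ψ.sum fun _ z => ‖z‖ ^ 2

/-- Elementary quantum gates. Classical expressions in them are evaluated in the classical memory.
* `had q e`: the Hadamard gate on each of the `e` lowest bits of `q`;
* `load q e`: `q ← q XOR e`;
* `ask r v q`: the black-box query `r ← r XOR entry(v, q)`;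
* `fetch r A q`: the quantum read of classical memory `r ← r XOR A[q]`;
* `flip l`: the sign `-1` on the basis states with `q = e` for all pairs `(q, e)` in `l`. -/
inductive Gate
  | had (q : QReg) (e : Arith)
  | load (q : QReg) (e : Arith)
  | ask (r : QReg) (v : Arith) (q : QReg) (h : r ≠ q)
  | fetch (r : QReg) (A : Arr) (q : QReg) (h : r ≠ q)
  | flip (l : List (QReg × Arith))

/-- The number of positions `j < k` where `a` and `b` both have the binary digit `1`. -/
def dotBits (k a b : ℕ) : ℕ :=
  ((Finset.range k).filter fun j => a.testBit j = true ∧ b.testBit j = true).card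

open Classical in
/-- The image of a basis state under a gate. -/
noncomputable def Gate.onBasis (B : BlackBox) (μ : Mem) (b : Basis) : Gate → QState
  | had q e =>
      ∑ d ∈ Finset.range (2 ^ e.eval μ),
        Finsupp.single (Function.update b q (b q / 2 ^ e.eval μ * 2 ^ e.eval μ + d))
          ((-1 : ℂ) ^ dotBits (e.eval μ) (b q) d / ((√((2 : ℝ) ^ e.eval μ) : ℝ) : ℂ))
  | load q e => Finsupp.single (Function.update b q (b q ^^^ e.eval μ)) 1
  | ask r v q _ => Finsupp.single (Function.update b r (b r ^^^ B.entry (v.eval μ) (b q))) 1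
  | fetch r A q _ => Finsupp.single (Function.update b r (b r ^^^ μ.arrs A (b q))) 1
  | flip l => Finsupp.single b (if ∀ p ∈ l, b p.1 = p.2.eval μ then -1 else 1)

/-- Gates act linearly. -/
noncomputable def Gate.apply (B : BlackBox) (μ : Mem) (g : Gate) (ψ : QState) : QState :=
  ψ.sum fun b z => z • g.onBasis B μ b

/-! ### Programs and their running time -/

inductive Cmd
  /-- `x ← e` -/
  | set (x : Var) (e : Arith)
  /-- `A[j] ← e` -/
  | put (A : Arr) (j e : Arith)
  /-- black-box query: `x ←` length of the list of `v` -/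
  | len (x : Var) (v : Arith)
  /-- black-box query: `x ← entry(v, j)` -/
  | ask (x : Var) (v j : Arith)
  /-- one quantum gate -/
  | gate (g : Gate)
  /-- measure the quantum word `q` in the computational basis, put the outcome into `x` -/
  | meas (x : Var) (q : QReg)
  /-- if `t` then run `c` -/
  | cond (t : Test) (c : List Cmd)
  /-- while `t` run `c` -/
  | loop (t : Test) (c : List Cmd)

open Classical in
/-- `haltProb B good T p μ ψ` is the probability that the program `p`, started with classical memory
`μ` and quantum words in state `ψ`, halts after at most `T` steps with a classical memory that
satisfies `good`. Every executed instruction and every evaluated test is one step. -/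
noncomputable def haltProb (B : BlackBox) (good : Mem → Prop) :
    ℕ → List Cmd → Mem → QState → ℝ
  | _, [], μ, ψ => if good μ then ψ.normSq else 0
  | 0, _ :: _, _, _ => 0
  | T + 1, .set x e :: p, μ, ψ => haltProb B good T p (μ.setVar x (e.eval μ)) ψ
  | T + 1, .put A j e :: p, μ, ψ => haltProb B good T p (μ.setArr A (j.eval μ) (e.eval μ)) ψ
  | T + 1, .len x v :: p, μ, ψ => haltProb B good T p (μ.setVar x (B.len (v.eval μ))) ψ
  | T + 1, .ask x v j :: p, μ, ψ =>
      haltProb B good T p (μ.setVar x (B.entry (v.eval μ) (j.eval μ))) ψ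
  | T + 1, .gate g :: p, μ, ψ => haltProb B good T p μ (g.apply B μ ψ)
  | T + 1, .meas x q :: p, μ, ψ =>
      ∑ o ∈ ψ.support.image (fun b => b q),
        haltProb B good T p (μ.setVar x o) (ψ.filter fun b => b q = o)
  | T + 1, .cond t c :: p, μ, ψ =>
      if t.holds μ then haltProb B good T (c ++ p) μ ψ else haltProb B good T p μ ψ
  | T + 1, .loop t c :: p, μ, ψ =>
      if t.holds μ then haltProb B good T (c ++ .loop t c :: p) μ ψ else haltProb B good T p μ ψ

/-! ### Quantum breadth-first search

The word `size` (the number `n` of vertices) in the array `lay` stands for the layer number `∞`. -/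

open Arith in
/-- `x ← x + 1` -/
def incr (x : Var) : Cmd := .set x (plus (var x) (lit 1))

/-- The two ways in which the graph is given. -/
inductive Model
  | adjacency | list

open Arith in
/-- The phase oracle of Grover's search: the sign `-1` on the indices `idx` that lead from the vertex
`cur` to a neighbour whose layer number is `∞`. -/
def oracle : Model → List Cmd
  | .adjacency => [
      .gate (.ask .out (var .cur) .idx (by decide)),
      .gate (.fetch .lab .lay .idx (by decide)),
      .gate (.flip [(.out, lit 1), (.lab, var .size)]),
      .gate (.fetch .lab .lay .idx (by decide)),
      .gate (.ask .out (var .cur) .idx (by decide))]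
  | .list => [
      .gate (.ask .out (var .cur) .idx (by decide)),
      .gate (.fetch .lab .lay .out (by decide)),
      .gate (.flip [(.lab, var .size)]),
      .gate (.fetch .lab .lay .out (by decide)),
      .gate (.ask .out (var .cur) .idx (by decide))]

open Arith in
/-- The classical check of a measured index `i`: on success `y` is an undiscovered neighbour of `cur`. -/
def check : Model → List Cmd
  | .adjacency => [
      .ask .z (var .cur) (var .i),
      .set .y (var .i),
      .cond (.both (.eq (var .z) (lit 1)) (.eq (get .lay (var .y)) (var .size)))
        [.set .found (lit 1)]]
  | .list => [
      .ask .y (var .cur) (var .i),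
      .cond (.eq (get .lay (var .y)) (var .size)) [.set .found (lit 1)]]

open Arith in
/-- The number of entries of the row, respectively the list, of `cur`. -/
def degree : Model → Cmd
  | .adjacency => .set .deg (var .size)
  | .list => .len .deg (var .cur)

open Arith in
/-- One run of Grover's algorithm on `2 ^ bits` indices: the number of iterations is drawn uniformly
from `{0, …, 2 ^ stage - 1}`, then the iterations are made, then the index is measured and checked.
The word `idx` is returned to `0` after each of the two measurements. -/
def groverRun (M : Model) : List Cmd :=
  [ .gate (.had .idx (var .stage)),
    .meas .iter .idx,
    .gate (.load .idx (var .iter)),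
    .gate (.had .idx (var .bits)),
    .loop (.lt (lit 0) (var .iter)) (
      oracle M ++
      [ .gate (.had .idx (var .bits)),
        .gate (.flip [(.idx, lit 0)]),
        .gate (.had .idx (var .bits)),
        .set .iter (minus (var .iter) (lit 1))]),
    .meas .i .idx,
    .gate (.load .idx (var .i))] ++
  check M

open Arith in
/-- Grover's search with an unknown number of solutions: the bound `2 ^ stage` on the number of
iterations is doubled from `1` on, as long as `2 * stage ≤ bits + 2`, with `reps` runs per stage,
until a run finds an undiscovered neighbour `y` of `cur`. -/
def search (M : Model) : List Cmd :=
  [ .set .found (lit 0),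
    .set .stage (lit 0),
    .loop (.both (.eq (var .found) (lit 0))
        (.lt (plus (var .stage) (var .stage)) (plus (var .bits) (lit 3))))
      [ .set .rep (lit 0),
        .loop (.both (.eq (var .found) (lit 0)) (.lt (var .rep) (var .reps)))
          (groverRun M ++ [incr .rep]),
        incr .stage]]

open Arith in
/-- Find all neighbours of `cur` with layer number `∞` by Grover's search, give them the layer number
of `cur` plus one, and append them to the queue. First `bits` is computed as the least number with
`deg ≤ 2 ^ bits`. -/
def process (M : Model) : List Cmd :=
  [ degree M,
    .set .bits (lit 0),
    .set .dim (lit 1),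
    .loop (.lt (var .dim) (var .deg)) [.set .dim (plus (var .dim) (var .dim)), incr .bits],
    .set .found (lit 1),
    .loop (.eq (var .found) (lit 1)) (
      search M ++
      [ .cond (.eq (var .found) (lit 1))
        [ .put .lay (var .y) (plus (get .lay (var .cur)) (lit 1)),
          .put .queue (var .tail) (var .y),
          incr .tail]])]

open Arith in
/-- Quantum breadth-first search from the vertex `src`. Each stage of each search is repeated
`reps = c * (1 + ⌈log₂ n⌉)` times. -/
def bfs (M : Model) (c : ℕ) : List Cmd :=
  [ .set .reps (lit c),
    .set .dim (lit 1),
    .loop (.lt (var .dim) (var .size))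
      [.set .dim (plus (var .dim) (var .dim)), .set .reps (plus (var .reps) (lit c))],
    .set .i (lit 0),
    .loop (.lt (var .i) (var .size)) [.put .lay (var .i) (var .size), incr .i],
    .put .lay (var .src) (lit 0),
    .put .queue (lit 0) (var .src),
    .set .head (lit 0),
    .set .tail (lit 1),
    .loop (.lt (var .head) (var .tail)) (
      [.set .cur (get .queue (var .head))] ++ process M ++ [incr .head])]

/-! ### Inputs and outputs -/

/-- The number of edges. -/
noncomputable def edgeCount {n : ℕ} (G : Digraph (Fin n)) : ℕ :=
  {p : Fin n × Fin n | G.Adj p.1 p.2}.ncard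

/-- The underlying undirected graph is connected. -/
def IsConnected {n : ℕ} (G : Digraph (Fin n)) : Prop :=
  (SimpleGraph.fromRel G.Adj).Connected

open Classical in
/-- The adjacency matrix as a black box (list lengths are not used). -/
noncomputable def adjacencyBox {n : ℕ} (G : Digraph (Fin n)) : BlackBox where
  len _ := 0
  entry v w := if ∃ (hv : v < n) (hw : w < n), G.Adj ⟨v, hv⟩ ⟨w, hw⟩ then 1 else 0

/-- Arrays of neighbours; `none` is a hole. -/
structure Lists (n : ℕ) where
  deg : Fin n → ℕ
  deg_le : ∀ v, deg v ≤ n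
  entry : (v : Fin n) → Fin (deg v) → Option (Fin n)

/-- The entries of the array of `v`, apart from holes, are the heads of the edges from `v`. -/
def Lists.Represents {n : ℕ} (N : Lists n) (G : Digraph (Fin n)) : Prop :=
  ∀ v w, G.Adj v w ↔ ∃ j, N.entry v j = some w

/-- The total length of the arrays. -/
def Lists.length {n : ℕ} (N : Lists n) : ℕ := ∑ v, N.deg v

/-- The arrays as a black box. A vertex is given by its number, a hole by `n`. -/
def Lists.box {n : ℕ} (N : Lists n) : BlackBox where
  len v := if hv : v < n then N.deg ⟨v, hv⟩ else 0
  entry v j :=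
    if hv : v < n then
      if hj : j < N.deg ⟨v, hv⟩ then
        match N.entry ⟨v, hv⟩ ⟨j, hj⟩ with
        | some w => w
        | none => n
      else n
    else n

/-- The layer numbers from `a`: `ℓ(a) = 0` and `ℓ(y) = 1 + min {ℓ(x) : (x, y) ∈ E}` for `y ≠ a`,
where the minimum of the empty set is `∞`. -/
def IsLayering {n : ℕ} (G : Digraph (Fin n)) (a : Fin n) (l : Fin n → ℕ∞) : Prop :=
  l a = 0 ∧ ∀ y, y ≠ a → l y = 1 + ⨅ (x) (_ : G.Adj x y), l x

/-- The layer numbers that are stored in the memory. -/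
def storedLayers (n : ℕ) (μ : Mem) (v : Fin n) : ℕ∞ :=
  if μ.arrs .lay v = n then ⊤ else (μ.arrs .lay v : ℕ∞)

/-- Initially the memory holds the number of vertices, the starting vertex, and zeros. -/
def initMem (n a : ℕ) : Mem where
  vars v :=
    match v with
    | .size => n
    | .src => a
    | _ => 0
  arrs _ _ := 0

/-- Initially all quantum words are `0`. -/
noncomputable def initState : QState := Finsupp.single (fun _ => 0) 1

/-- The probability that quantum breadth-first search on a given black box halts after at most `T`
steps and then has stored the correct layer numbers. -/
noncomputable def successProb (M : Model) (c : ℕ) (B : BlackBox) {n : ℕ} (G : Digraph (Fin n))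
    (a : Fin n) (T : ℕ) : ℝ :=
  haltProb B (fun μ => IsLayering G a (storedLayers n μ)) T (bfs M c) (initMem n a) initState

end QBFS

/-!
Quantum breadth-first search is ordinary breadth-first search in which the undiscovered neighbours of
a vertex are found by Grover's search, so there are three things to prove.

*Grover's algorithm.* On the machine, the five instructions of the oracle flip the sign of the marked
indices and restore the other quantum words (`haltProb_oracle`). Conjugating the sign flip of the index
`0` by Hadamard gates is the reflection at the mean, by the orthogonality of the characters of
`(ℤ/2)ᵏ` (`hadamard_flip_hadamard`). So the amplitudes rotate by `2 θ`, where `sin² θ = t / N` for `t`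
solutions among `N` indices (`groverAmp_eq`), and if `4 ^ s * t ≥ N` and `t < 3 N / 4`, a number of
iterations drawn uniformly from `{0, …, 2 ^ s - 1}` gives success probability at least `1 / 4`; for
`t ≥ 3 N / 4` no iteration is needed (`exists_groverSuccess`). After each measurement the word `idx` is
reset, so every branch continues from the zero state, up to a scalar that carries the probability of
the branch.

*Time.* No concentration inequality is needed. With `R = 5 (1 + ⌈log₂ n⌉)` runs per stage, the good
stage of one search fails with probability at most `(3 / 4) ^ R ≤ 1 / n²`, and fewer than `n` searches
have solutions. If none of these fails, then all times are bounded deterministically: a search with `t`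
solutions takes `O(R √(N / t))` steps and one without solutions `O(R √N)` steps (`ens_search_found`,
`ens_search_none`). Since `1 / √1 + … + 1 / √u ≤ 2 √u`, a vertex `v` with `u_v` newly discovered
neighbours and search size `N_v` takes `O(R √(N_v (u_v + 1)))` steps (`ens_process`), and by the
Cauchy-Schwarz inequality this sums up to `O(R √(n ∑ N_v))` (`ens_queueLoop`). Finally `∑ N_v` is
`O(n²)` for an adjacency matrix and `O(L)` for lists, as `L ≥ n - 1` in a connected graph.

*Correctness.* A measured index is checked classically, so only true neighbours are ever recorded, and
the usual invariant of breadth-first search (`Inv`) yields the layer numbers (`Inv.isLayering`).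

These parts are combined in a program logic. `Ens B good δ t c μ Q` says that from memory `μ`, with
probability at least `δ`, the code `c` ends within `t` steps in a memory that satisfies `Q`; it is
expressed by a lower bound for `haltProb` of every continuation of `c`.
-/

namespace QBFS

/-! ### Halting probabilities -/

section Basic

variable {B : BlackBox} {good : Mem → Prop}

theorem QState.normSq_nonneg (ψ : QState) : 0 ≤ ψ.normSq :=
  Finset.sum_nonneg fun _ _ => by positivity

theorem QState.normSq_smul (z : ℂ) (ψ : QState) : (z • ψ).normSq = ‖z‖ ^ 2 * ψ.normSq := by
  unfold QState.normSq
  rw [Finsupp.sum_smul_index (by simp), Finsupp.sum, Finsupp.sum, Finset.mul_sum]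
  exact Finset.sum_congr rfl fun b _ => by rw [norm_mul, mul_pow]

theorem Gate.apply_smul (μ : Mem) (g : Gate) (z : ℂ) (ψ : QState) :
    g.apply B μ (z • ψ) = z • g.apply B μ ψ := by
  unfold Gate.apply
  rw [Finsupp.sum_smul_index (by simp), Finsupp.smul_sum]
  simp only [mul_smul]

theorem haltProb_nil (T : ℕ) (μ : Mem) (ψ : QState) [Decidable (good μ)] :
    haltProb B good T [] μ ψ = if good μ then ψ.normSq else 0 := by
  cases T <;> simp [haltProb]

theorem haltProb_nonneg (T : ℕ) (p : List Cmd) (μ : Mem) (ψ : QState) :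
    0 ≤ haltProb B good T p μ ψ := by
  classical
  induction T generalizing p μ ψ with
  | zero =>
    cases p with
    | nil => rw [haltProb_nil]; split_ifs <;> simp [ψ.normSq_nonneg]
    | cons => simp [haltProb]
  | succ T ih =>
    rcases p with _ | ⟨c, p⟩
    · rw [haltProb_nil]; split_ifs <;> simp [ψ.normSq_nonneg]
    · cases c <;> simp only [haltProb] <;> first
        | exact ih _ _ _
        | exact Finset.sum_nonneg fun _ _ => ih _ _ _
        | (split_ifs <;> exact ih _ _ _)

theorem haltProb_le_succ (T : ℕ) (p : List Cmd) (μ : Mem) (ψ : QState) :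
    haltProb B good T p μ ψ ≤ haltProb B good (T + 1) p μ ψ := by
  classical
  induction T generalizing p μ ψ with
  | zero =>
    cases p with
    | nil => rw [haltProb_nil, haltProb_nil]
    | cons => rw [haltProb]; exact haltProb_nonneg _ _ _ _
  | succ T ih =>
    rcases p with _ | ⟨c, p⟩
    · rw [haltProb_nil, haltProb_nil]
    · cases c <;> rw [haltProb, haltProb] <;> first
        | exact ih _ _ _
        | exact Finset.sum_le_sum fun _ _ => ih _ _ _
        | (split_ifs <;> exact ih _ _ _)

theorem haltProb_mono {S T : ℕ} (h : S ≤ T) (p : List Cmd) (μ : Mem) (ψ : QState) :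
    haltProb B good S p μ ψ ≤ haltProb B good T p μ ψ :=
  monotone_nat_of_le_succ (f := fun T => haltProb B good T p μ ψ)
    (fun T => haltProb_le_succ T p μ ψ) h

theorem haltProb_smul (T : ℕ) (p : List Cmd) (μ : Mem) (z : ℂ) (ψ : QState) :
    haltProb B good T p μ (z • ψ) = ‖z‖ ^ 2 * haltProb B good T p μ ψ := by
  classical
  induction T generalizing p μ ψ with
  | zero =>
    cases p with
    | nil => rw [haltProb_nil, haltProb_nil]; split_ifs <;> simp [QState.normSq_smul]
    | cons => simp [haltProb]
  | succ T ih =>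
    rcases p with _ | ⟨c, p⟩
    · rw [haltProb_nil, haltProb_nil]; split_ifs <;> simp [QState.normSq_smul]
    · cases c with
      | gate g => rw [haltProb, haltProb, Gate.apply_smul, ih]
      | meas x q =>
        rw [haltProb, haltProb, Finset.mul_sum]
        rcases eq_or_ne z 0 with rfl | hz
        · simp
        · rw [Finsupp.support_smul_eq hz]
          exact Finset.sum_congr rfl fun o _ => by rw [Finsupp.filter_smul, ih]
      | cond t c => rw [haltProb, haltProb]; split_ifs <;> exact ih _ _ _
      | loop t c => rw [haltProb, haltProb]; split_ifs <;> exact ih _ _ _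
      | _ => rw [haltProb, haltProb, ih]

theorem haltProb_zero (T : ℕ) (p : List Cmd) (μ : Mem) : haltProb B good T p μ 0 = 0 := by
  simpa using haltProb_smul (B := B) (good := good) T p μ 0 0

end Basic

/-! ### Lower bounds on halting probabilities -/

/-- The probability that `p`, started with all quantum words `0`, halts well within `T` steps. Real
time bounds make it possible to add up bounds that are not integers. -/
noncomputable def prob (B : BlackBox) (good : Mem → Prop) (T : ℝ) (p : List Cmd) (μ : Mem) : ℝ :=
  haltProb B good ⌊T⌋₊ p μ initState

/-- With probability at least `δ` the program `c`, started in memory `μ` with all quantum words `0`,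
ends within `t` steps, again with all quantum words `0`, in a memory that satisfies `Q`. This is
expressed by its effect on the halting probabilities of all continuations of `c`. -/
def Ens (B : BlackBox) (good : Mem → Prop) (δ t : ℝ) (c : List Cmd) (μ : Mem) (Q : Mem → Prop) :
    Prop :=
  0 ≤ t ∧ ∀ (k : List Cmd) (T q : ℝ), 0 ≤ T → 0 ≤ q → (∀ μ', Q μ' → q ≤ prob B good T k μ') →
    δ * q ≤ prob B good (T + t) (c ++ k) μ

section Ens

variable {B : BlackBox} {good : Mem → Prop} {δ δ' t t' : ℝ} {c : List Cmd} {μ : Mem}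
  {Q Q' : Mem → Prop}

theorem prob_nonneg (T : ℝ) (p : List Cmd) (μ : Mem) : 0 ≤ prob B good T p μ :=
  haltProb_nonneg _ _ _ _

theorem prob_mono {S T : ℝ} (h : S ≤ T) (p : List Cmd) (μ : Mem) :
    prob B good S p μ ≤ prob B good T p μ :=
  haltProb_mono (Nat.floor_mono h) _ _ _

theorem Ens.nil (h : Q μ) : Ens B good 1 0 [] μ Q :=
  ⟨le_rfl, fun k T q _ _ hq => by simpa using hq μ h⟩

theorem Ens.mono (h : Ens B good δ t c μ Q) (hδ : δ' ≤ δ) (ht : t ≤ t')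
    (hQ : ∀ μ', Q μ' → Q' μ') : Ens B good δ' t' c μ Q' := by
  refine ⟨h.1.trans ht, fun k T q hT hq hk => ?_⟩
  calc δ' * q ≤ δ * q := mul_le_mul_of_nonneg_right hδ hq
    _ ≤ prob B good (T + t) (c ++ k) μ := h.2 k T q hT hq fun μ' h' => hk μ' (hQ μ' h')
    _ ≤ _ := prob_mono (by linarith) _ _

theorem Ens.seq {c' : List Cmd} {Q' : Mem → Prop} (h : Ens B good δ t c μ Q) (hδ : 0 ≤ δ')
    (h' : ∀ μ', Q μ' → Ens B good δ' t' c' μ' Q') (ht : 0 ≤ t') :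
    Ens B good (δ * δ') (t + t') (c ++ c') μ Q' := by
  refine ⟨add_nonneg h.1 ht, fun k T q hT hq hk => ?_⟩
  rw [mul_assoc, List.append_assoc, add_comm t, ← add_assoc]
  exact h.2 _ _ _ (by positivity) (by positivity) fun μ' hμ' => (h' μ' hμ').2 k T q hT hq hk

theorem Ens.seq_one {c' : List Cmd} {Q' : Mem → Prop} (h : Ens B good 1 t c μ Q)
    (h' : ∀ μ', Q μ' → Ens B good δ t' c' μ' Q') (ht : 0 ≤ t') (hδ : 0 ≤ δ) :
    Ens B good δ (t + t') (c ++ c') μ Q' := by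
  simpa using h.seq hδ h' ht

/-- An instruction that only replaces the memory `μ` by `μ'` costs one step. -/
theorem Ens.step {a : Cmd} {p : List Cmd} {μ' : Mem}
    (ha : ∀ T k, haltProb B good (T + 1) (a :: (c ++ k)) μ initState =
      haltProb B good T (p ++ k) μ' initState)
    (h : Ens B good δ t p μ' Q) : Ens B good δ (t + 1) (a :: c) μ Q := by
  refine ⟨add_nonneg h.1 zero_le_one, fun k T q hT hq hk => ?_⟩
  have := h.2 k T q hT hq hk
  rwa [prob, ← add_assoc, Nat.floor_add_one (add_nonneg hT h.1), List.cons_append, ha]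

theorem Ens.set {x : Var} {e : Arith} (h : Ens B good δ t c (μ.setVar x (e.eval μ)) Q) :
    Ens B good δ (t + 1) (.set x e :: c) μ Q :=
  Ens.step (fun T k => by rw [haltProb]) h

theorem Ens.put {A : Arr} {j e : Arith}
    (h : Ens B good δ t c (μ.setArr A (j.eval μ) (e.eval μ)) Q) :
    Ens B good δ (t + 1) (.put A j e :: c) μ Q :=
  Ens.step (fun T k => by rw [haltProb]) h

theorem Ens.len {x : Var} {v : Arith} (h : Ens B good δ t c (μ.setVar x (B.len (v.eval μ))) Q) :
    Ens B good δ (t + 1) (.len x v :: c) μ Q :=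
  Ens.step (fun T k => by rw [haltProb]) h

theorem Ens.ask {x : Var} {v j : Arith}
    (h : Ens B good δ t c (μ.setVar x (B.entry (v.eval μ) (j.eval μ))) Q) :
    Ens B good δ (t + 1) (.ask x v j :: c) μ Q :=
  Ens.step (fun T k => by rw [haltProb]) h

theorem Ens.cond_pos {s : Test} {d : List Cmd} (hs : s.holds μ)
    (h : Ens B good δ t (d ++ c) μ Q) : Ens B good δ (t + 1) (.cond s d :: c) μ Q :=
  Ens.step (fun T k => by rw [haltProb, if_pos hs, List.append_assoc]) h

theorem Ens.cond_neg {s : Test} {d : List Cmd} (hs : ¬ s.holds μ)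
    (h : Ens B good δ t c μ Q) : Ens B good δ (t + 1) (.cond s d :: c) μ Q :=
  Ens.step (fun T k => by rw [haltProb, if_neg hs]) h

theorem Ens.loop_pos {s : Test} {d : List Cmd} (hs : s.holds μ)
    (h : Ens B good δ t (d ++ .loop s d :: c) μ Q) :
    Ens B good δ (t + 1) (.loop s d :: c) μ Q :=
  Ens.step (fun T k => by rw [haltProb, if_pos hs, List.append_assoc, List.cons_append]) h

theorem Ens.loop_neg {s : Test} {d : List Cmd} (hs : ¬ s.holds μ)
    (h : Ens B good δ t c μ Q) : Ens B good δ (t + 1) (.loop s d :: c) μ Q :=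
  Ens.step (fun T k => by rw [haltProb, if_neg hs]) h

end Ens

/-! ### Characters of bit vectors -/

theorem dotBits_succ (k a b : ℕ) :
    (-1 : ℝ) ^ dotBits (k + 1) a b =
      (-1) ^ dotBits k a b * if a.testBit k = true ∧ b.testBit k = true then -1 else 1 := by
  unfold dotBits
  rw [Finset.range_add_one, Finset.filter_insert]
  split_ifs
  · rw [Finset.card_insert_of_notMem (by simp), pow_succ]
  · simp

theorem dotBits_zero_left (k b : ℕ) : dotBits k 0 b = 0 := by
  simp [dotBits]

theorem dotBits_zero_right (k a : ℕ) : dotBits k a 0 = 0 := by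
  simp [dotBits]

theorem dotBits_comm (k a b : ℕ) : dotBits k a b = dotBits k b a := by
  simp [dotBits, and_comm]

theorem dotBits_two_pow_add (k a d : ℕ) : dotBits k a (2 ^ k + d) = dotBits k a d := by
  unfold dotBits
  congr 1
  refine Finset.filter_congr fun j hj => ?_
  rw [Nat.testBit_two_pow_add_gt (Finset.mem_range.1 hj)]

theorem sum_range_two_pow_succ (k : ℕ) (f : ℕ → ℝ) :
    ∑ d ∈ Finset.range (2 ^ (k + 1)), f d = ∑ d ∈ Finset.range (2 ^ k), (f d + f (2 ^ k + d)) := by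
  rw [pow_succ, mul_two, Finset.sum_range_add, Finset.sum_add_distrib]

/-- The orthogonality relations of the characters of `(ℤ/2)ᵏ`. -/
theorem sum_characters (k a b : ℕ) :
    ∑ d ∈ Finset.range (2 ^ k), (-1 : ℝ) ^ dotBits k a d * (-1) ^ dotBits k b d =
      if ∀ j < k, a.testBit j = b.testBit j then 2 ^ k else 0 := by
  induction k with
  | zero => simp [dotBits]
  | succ k ih =>
    have key : ∀ d ∈ Finset.range (2 ^ k),
        ((-1 : ℝ) ^ dotBits (k + 1) a d * (-1) ^ dotBits (k + 1) b d +
          (-1) ^ dotBits (k + 1) a (2 ^ k + d) * (-1) ^ dotBits (k + 1) b (2 ^ k + d)) =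
        (if a.testBit k = b.testBit k then 2 else 0) *
          ((-1 : ℝ) ^ dotBits k a d * (-1) ^ dotBits k b d) := by
      intro d hd
      have hd : d < 2 ^ k := Finset.mem_range.1 hd
      simp only [dotBits_succ, dotBits_two_pow_add, Nat.testBit_lt_two_pow hd,
        Nat.testBit_two_pow_add_eq]
      cases a.testBit k <;> cases b.testBit k <;> simp <;> ring
    rw [sum_range_two_pow_succ, Finset.sum_congr rfl key, ← Finset.mul_sum, ih]
    simp only [Nat.lt_succ_iff_lt_or_eq, or_imp, forall_and, forall_eq]
    by_cases h1 : a.testBit k = b.testBit k <;>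
      by_cases h2 : ∀ j < k, a.testBit j = b.testBit j <;> simp [h1, h2, pow_succ, mul_comm]

theorem eq_of_testBit_lt {k a b : ℕ} (ha : a < 2 ^ k) (hb : b < 2 ^ k) :
    (∀ j < k, a.testBit j = b.testBit j) ↔ a = b := by
  refine ⟨fun h => Nat.eq_of_testBit_eq fun j => ?_, fun h _ _ => by rw [h]⟩
  rcases lt_or_ge j k with hj | hj
  · exact h j hj
  · have := Nat.pow_le_pow_right two_pos hj
    rw [Nat.testBit_lt_two_pow (ha.trans_le this), Nat.testBit_lt_two_pow (hb.trans_le this)]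

/-! ### Superpositions of indices -/

/-- The basis state with the given numbers in the quantum words `idx`, `out`, `lab`. -/
def ket (i o l : ℕ) : Basis
  | .idx => i
  | .out => o
  | .lab => l

@[simp] theorem update_ket_idx (i o l x : ℕ) : Function.update (ket i o l) .idx x = ket x o l := by
  funext r; cases r <;> simp [ket]

@[simp] theorem update_ket_out (i o l x : ℕ) : Function.update (ket i o l) .out x = ket i x l := by
  funext r; cases r <;> simp [ket]

@[simp] theorem update_ket_lab (i o l x : ℕ) : Function.update (ket i o l) .lab x = ket i o x := by
  funext r; cases r <;> simp [ket]

@[simp] theorem ket_idx (i o l : ℕ) : ket i o l .idx = i := rfl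
@[simp] theorem ket_out (i o l : ℕ) : ket i o l .out = o := rfl
@[simp] theorem ket_lab (i o l : ℕ) : ket i o l .lab = l := rfl

theorem initState_eq : initState = Finsupp.single (ket 0 0 0) 1 := by
  unfold initState
  congr 1
  funext r; cases r <;> rfl

/-- The superposition of the basis states `b i`, `i < N`, with real amplitudes `v i`. -/
noncomputable def superpos (N : ℕ) (b : ℕ → Basis) (v : ℕ → ℝ) : QState :=
  ∑ i ∈ Finset.range N, Finsupp.single (b i) (v i : ℂ)

/-- The superposition of the indices `i < N` with amplitudes `v i`, the other words being `0`. -/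
noncomputable def wave (N : ℕ) (v : ℕ → ℝ) : QState := superpos N (fun i => ket i 0 0) v

theorem wave_congr {N : ℕ} {v w : ℕ → ℝ} (h : ∀ i < N, v i = w i) : wave N v = wave N w := by
  unfold wave superpos
  exact Finset.sum_congr rfl fun i hi => by rw [h i (Finset.mem_range.1 hi)]

section Gates

variable {B : BlackBox} {μ : Mem}

theorem Gate.apply_single (g : Gate) (b : Basis) (z : ℂ) :
    g.apply B μ (Finsupp.single b z) = z • g.onBasis B μ b := by
  unfold Gate.apply
  exact Finsupp.sum_single_index (zero_smul _ _)

theorem Gate.apply_superpos (g : Gate) (N : ℕ) (b : ℕ → Basis) (v : ℕ → ℝ) :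
    g.apply B μ (superpos N b v) = ∑ i ∈ Finset.range N, (v i : ℂ) • g.onBasis B μ (b i) := by
  unfold superpos Gate.apply
  rw [← Finsupp.sum_finsetSum_index (by simp) (by simp [add_smul])]
  exact Finset.sum_congr rfl fun i _ => Finsupp.sum_single_index (zero_smul _ _)

theorem Gate.apply_load_single (q : QReg) (e : Arith) (b : Basis) (z : ℂ) :
    (Gate.load q e).apply B μ (Finsupp.single b z) =
      Finsupp.single (Function.update b q (b q ^^^ e.eval μ)) z := by
  simp [Gate.apply_single, Gate.onBasis]

theorem Gate.apply_ask_superpos (r : QReg) (v : Arith) (q : QReg) (h : r ≠ q) (N : ℕ)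
    (b : ℕ → Basis) (w : ℕ → ℝ) :
    (Gate.ask r v q h).apply B μ (superpos N b w) =
      superpos N (fun i => Function.update (b i) r (b i r ^^^ B.entry (v.eval μ) (b i q))) w := by
  rw [Gate.apply_superpos]
  simp [Gate.onBasis, superpos]

theorem Gate.apply_fetch_superpos (r : QReg) (A : Arr) (q : QReg) (h : r ≠ q) (N : ℕ)
    (b : ℕ → Basis) (w : ℕ → ℝ) :
    (Gate.fetch r A q h).apply B μ (superpos N b w) =
      superpos N (fun i => Function.update (b i) r (b i r ^^^ μ.arrs A (b i q))) w := by
  rw [Gate.apply_superpos]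
  simp [Gate.onBasis, superpos]

open Classical in
theorem Gate.apply_flip_superpos (l : List (QReg × Arith)) (N : ℕ) (b : ℕ → Basis) (w : ℕ → ℝ) :
    (Gate.flip l).apply B μ (superpos N b w) =
      superpos N b (fun i => if ∀ p ∈ l, b i p.1 = p.2.eval μ then -w i else w i) := by
  rw [Gate.apply_superpos, superpos]
  refine Finset.sum_congr rfl fun i _ => ?_
  simp only [Gate.onBasis, Finsupp.smul_single, smul_eq_mul]
  split_ifs <;> simp

/-- The Hadamard transform of the amplitudes on `2 ^ k` indices. -/
noncomputable def hadamard (k : ℕ) (v : ℕ → ℝ) (d : ℕ) : ℝ :=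
  (∑ a ∈ Finset.range (2 ^ k), v a * (-1) ^ dotBits k a d) / √(2 ^ k)

theorem Gate.apply_had_wave {e : Arith} {k : ℕ} (he : e.eval μ = k) (v : ℕ → ℝ) :
    (Gate.had .idx e).apply B μ (wave (2 ^ k) v) = wave (2 ^ k) (hadamard k v) := by
  rw [wave, Gate.apply_superpos, wave, superpos]
  simp only [Gate.onBasis, he, Finset.smul_sum, Finsupp.smul_single, ket_idx, update_ket_idx]
  rw [Finset.sum_comm]
  refine Finset.sum_congr rfl fun d _ => ?_
  rw [hadamard, Finset.sum_div, Complex.ofReal_sum, Finsupp.single_finsetSum]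
  refine Finset.sum_congr rfl fun a ha => ?_
  rw [Nat.div_eq_of_lt (Finset.mem_range.1 ha), zero_mul, zero_add]
  congr 1
  push_cast
  rw [smul_eq_mul, mul_div_assoc]

theorem Gate.apply_had_initState {e : Arith} {k : ℕ} (he : e.eval μ = k) :
    (Gate.had .idx e).apply B μ initState = wave (2 ^ k) (fun _ => 1 / √(2 ^ k)) := by
  rw [initState_eq, Gate.apply_single, one_smul, wave, superpos]
  simp only [Gate.onBasis, he, ket_idx, update_ket_idx, dotBits_zero_left]
  refine Finset.sum_congr rfl fun d _ => ?_
  simp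

/-- Conjugating the sign flip of the index `0` by Hadamard transforms gives the reflection at the
mean (up to the sign). -/
theorem hadamard_flip_hadamard (k : ℕ) (v : ℕ → ℝ) {d : ℕ} (hd : d < 2 ^ k) :
    hadamard k (fun i => if i = 0 then -hadamard k v i else hadamard k v i) d =
      v d - 2 * ((∑ a ∈ Finset.range (2 ^ k), v a) / 2 ^ k) := by
  have hs : √((2 : ℝ) ^ k) * √(2 ^ k) = 2 ^ k := Real.mul_self_sqrt (by positivity)
  have hp : (0 : ℝ) < √(2 ^ k) := by positivity
  have h0 : (0 : ℕ) ∈ Finset.range (2 ^ k) := by simp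
  have inv : ∑ a ∈ Finset.range (2 ^ k), hadamard k v a * (-1) ^ dotBits k a d =
      v d * √(2 ^ k) := by
    have : ∀ a, hadamard k v a * (-1) ^ dotBits k a d = ∑ b ∈ Finset.range (2 ^ k),
        v b / √(2 ^ k) * ((-1) ^ dotBits k b a * (-1) ^ dotBits k d a) := by
      intro a
      rw [hadamard, Finset.sum_div, Finset.sum_mul, dotBits_comm k a d]
      exact Finset.sum_congr rfl fun b _ => by ring
    simp only [this]
    rw [Finset.sum_comm, Finset.sum_eq_single d]
    · rw [← Finset.mul_sum, sum_characters, if_pos (by simp), div_mul_eq_mul_div,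
        div_eq_iff hp.ne', mul_assoc, hs]
    · intro b hb hbd
      rw [← Finset.mul_sum, sum_characters,
        if_neg (by rw [eq_of_testBit_lt (Finset.mem_range.1 hb) hd]; exact hbd), mul_zero]
    · simp [hd]
  have split : ∀ a, (if a = 0 then -hadamard k v a else hadamard k v a) * (-1) ^ dotBits k a d =
      hadamard k v a * (-1) ^ dotBits k a d - if a = 0 then 2 * hadamard k v 0 else 0 := by
    intro a
    split_ifs with h
    · subst h; rw [dotBits_zero_left]; ring
    · ring
  rw [hadamard]
  simp only [split]
  rw [Finset.sum_sub_distrib, inv, Finset.sum_ite_eq' _ 0, if_pos h0, sub_div,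
    mul_div_cancel_right₀ _ hp.ne', hadamard]
  simp only [dotBits_zero_right, pow_zero, mul_one]
  rw [← mul_div_assoc, div_div, hs, mul_div_assoc]

end Gates

/-! ### Grover's algorithm on the machine -/

/-- The vertex to which the `i`-th entry of the row or list of `v` leads, `n` if there is none. -/
def target (M : Model) (B : BlackBox) (n v i : ℕ) : ℕ :=
  match M with
  | .adjacency => if B.entry v i = 1 then i else n
  | .list => B.entry v i

/-- The index `i` leads from the vertex `cur` to a vertex with layer number `∞`. -/
def Marked (M : Model) (B : BlackBox) (μ : Mem) (i : ℕ) : Prop :=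
  μ.arrs .lay (target M B (μ.vars .size) (μ.vars .cur) i) = μ.vars .size

open Classical in
/-- One iteration of Grover's algorithm on the amplitudes: the sign of the solutions `S` is flipped,
then the amplitudes are reflected at their mean. -/
noncomputable def groverStep (S : ℕ → Prop) (N : ℕ) (v : ℕ → ℝ) (i : ℕ) : ℝ :=
  (if S i then -v i else v i) -
    2 * ((∑ a ∈ Finset.range N, if S a then -v a else v a) / N)

section Run

variable {B : BlackBox} {good : Mem → Prop} {M : Model} {μ : Mem}

open Classical in
theorem haltProb_oracle (hμ : μ.arrs .lay (μ.vars .size) ≠ μ.vars .size) (T N : ℕ)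
    (p : List Cmd) (v : ℕ → ℝ) :
    haltProb B good (T + 5) (oracle M ++ p) μ (wave N v) =
      haltProb B good T p μ (wave N fun i => if Marked M B μ i then -v i else v i) := by
  cases M
  · simp only [oracle, List.cons_append, List.nil_append, haltProb, wave, Gate.apply_ask_superpos,
      Gate.apply_fetch_superpos, Gate.apply_flip_superpos, ket_idx, ket_out, ket_lab,
      update_ket_out, update_ket_lab, Arith.eval, Nat.zero_xor, Nat.xor_self]
    congr 2
    funext i
    simp only [List.forall_mem_cons, List.not_mem_nil, false_imp_iff, implies_true, and_true,
      ket_out, ket_lab, Arith.eval, Marked, target]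
    by_cases h : B.entry (μ.vars .cur) i = 1 <;> simp [h, hμ]
  · simp only [oracle, List.cons_append, List.nil_append, haltProb, wave, Gate.apply_ask_superpos,
      Gate.apply_fetch_superpos, Gate.apply_flip_superpos, ket_idx, ket_out, ket_lab,
      update_ket_out, update_ket_lab, Arith.eval, Nat.zero_xor, Nat.xor_self]
    congr 2
    funext i
    simp only [List.forall_mem_cons, List.not_mem_nil, false_imp_iff, implies_true, and_true,
      ket_lab, Arith.eval, Marked, target]
    congr

theorem Mem.setVar_setVar (x : Var) (a b : ℕ) : (μ.setVar x a).setVar x b = μ.setVar x b := by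
  simp [Mem.setVar]

theorem Mem.setVar_eq_self {x : Var} {a : ℕ} (h : μ.vars x = a) : μ.setVar x a = μ := by
  subst h; simp [Mem.setVar]

/-- The loop of the Grover iterations; each of them takes ten steps. -/
theorem haltProb_iterations {k : ℕ} (hμ : μ.arrs .lay (μ.vars .size) ≠ μ.vars .size)
    (hk : μ.vars .bits = k) (T j : ℕ) (hj : μ.vars .iter = j) (p : List Cmd) (v : ℕ → ℝ) :
    haltProb B good (T + 10 * j + 1) (.loop (.lt (.lit 0) (.var .iter)) (
      oracle M ++
      [ .gate (.had .idx (.var .bits)),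
        .gate (.flip [(.idx, .lit 0)]),
        .gate (.had .idx (.var .bits)),
        .set .iter (.minus (.var .iter) (.lit 1))]) :: p) μ (wave (2 ^ k) v) =
      haltProb B good T p (μ.setVar .iter 0)
        (wave (2 ^ k) ((groverStep (Marked M B μ) (2 ^ k))^[j] v)) := by
  classical
  induction j generalizing μ v with
  | zero =>
    rw [haltProb, if_neg (by simp [Test.holds, Arith.eval, hj]), Mem.setVar_eq_self hj]
    rfl
  | succ j ih =>
    rw [haltProb, if_pos (by simp [Test.holds, Arith.eval, hj])]
    rw [show T + 10 * (j + 1) = (T + 10 * j + 1) + 1 + 1 + 1 + 1 + 5 by ring, List.append_assoc,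
      haltProb_oracle hμ]
    simp only [List.cons_append, List.nil_append]
    rw [haltProb, haltProb, haltProb, haltProb, Gate.apply_had_wave (k := k) (by simpa [Arith.eval] using hk), wave,
      Gate.apply_flip_superpos, ← wave,
      Gate.apply_had_wave (k := k) (by simpa [Arith.eval] using hk)]
    have e : ∀ w : ℕ → ℝ, ∀ i < 2 ^ k,
        hadamard k (fun i => if ∀ p ∈ [(QReg.idx, Arith.lit 0)], ket i 0 0 p.1 = p.2.eval μ
          then -hadamard k w i else hadamard k w i) i =
        w i - 2 * ((∑ a ∈ Finset.range (2 ^ k), w a) / 2 ^ k) := by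
      intro w i hi
      rw [← hadamard_flip_hadamard k w hi]
      simp [Arith.eval]
    rw [wave_congr (e _)]
    have hm : Marked M B (μ.setVar .iter j) = Marked M B μ := by
      funext i; simp [Marked, Mem.setVar]
    have := ih (μ := μ.setVar .iter j) (by simpa [Mem.setVar] using hμ)
      (by simpa [Mem.setVar] using hk) (by simp [Mem.setVar])
      (groverStep (Marked M B μ) (2 ^ k) v)
    rw [hm, Mem.setVar_setVar] at this
    rw [Function.iterate_succ_apply, ← this]
    simp only [Arith.eval, hj, Nat.add_sub_cancel]
    have hw : (wave (2 ^ k) fun i => (if Marked M B μ i then -v i else v i) -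
        2 * ((∑ a ∈ Finset.range (2 ^ k), if Marked M B μ a then -v a else v a) / 2 ^ k)) =
        wave (2 ^ k) (groverStep (Marked M B μ) (2 ^ k) v) :=
      wave_congr fun i _ => by simp [groverStep]
    rw [hw]

theorem wave_filter {N : ℕ} (v : ℕ → ℝ) {o : ℕ} (ho : o < N) :
    (wave N v).filter (fun b => b .idx = o) = Finsupp.single (ket o 0 0) (v o : ℂ) := by
  classical
  rw [wave, superpos, Finsupp.filter_sum, Finset.sum_eq_single o]
  · rw [Finsupp.filter_single_of_pos _ (by simp)]
  · intro b _ hb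
    rw [Finsupp.filter_single_of_neg _ (by simpa using hb)]
  · simp [ho]

theorem haltProb_meas (T N : ℕ) (x : Var) (p : List Cmd) (v : ℕ → ℝ) :
    haltProb B good (T + 2) (.meas x .idx :: .gate (.load .idx (.var x)) :: p) μ (wave N v) =
      ∑ o ∈ Finset.range N, v o ^ 2 * haltProb B good T p (μ.setVar x o) initState := by
  classical
  rw [haltProb]
  have hsub : (wave N v).support.image (fun b => b .idx) ⊆ Finset.range N := by
    intro o ho
    obtain ⟨b, hb, rfl⟩ := Finset.mem_image.1 ho
    obtain ⟨i, hi, hb⟩ := Finset.mem_biUnion.1 (Finsupp.support_finsetSum hb)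
    rw [Finset.mem_singleton.1 (Finsupp.support_single_subset hb)]
    simpa using hi
  have branch : ∀ o ∈ Finset.range N,
      haltProb B good (T + 1) (.gate (.load .idx (.var x)) :: p) (μ.setVar x o)
        ((wave N v).filter fun b => b .idx = o) =
      v o ^ 2 * haltProb B good T p (μ.setVar x o) initState := by
    intro o ho
    rw [wave_filter v (Finset.mem_range.1 ho), haltProb, Gate.apply_load_single, ket_idx,
      show Arith.eval (μ.setVar x o) (.var x) = o by simp [Arith.eval, Mem.setVar], Nat.xor_self,
      update_ket_idx, ← mul_one (v o : ℂ), ← smul_eq_mul, ← Finsupp.smul_single, ← initState_eq,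
      haltProb_smul, Complex.norm_real, Real.norm_eq_abs, sq_abs]
  rw [← Finset.sum_congr rfl branch]
  refine Finset.sum_subset hsub fun o _ ho => ?_
  rw [(Finsupp.filter_eq_zero_iff _ _).2, haltProb_zero]
  intro b hb
  by_contra h
  exact ho (Finset.mem_image.2 ⟨b, Finsupp.mem_support_iff.2 h, hb⟩)

/-- The distribution of the measured index in a run of Grover's algorithm. -/
theorem haltProb_groverRun {k s : ℕ} (hμ : μ.arrs .lay (μ.vars .size) ≠ μ.vars .size)
    (hk : μ.vars .bits = k) (hs : μ.vars .stage = s) (T : ℕ) (p : List Cmd) :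
    ∑ j ∈ Finset.range (2 ^ s), 1 / 2 ^ s * ∑ i ∈ Finset.range (2 ^ k),
      (groverStep (Marked M B μ) (2 ^ k))^[j] (fun _ => 1 / √(2 ^ k)) i ^ 2 *
        haltProb B good T (check M ++ p) ((μ.setVar .iter 0).setVar .i i) initState ≤
      haltProb B good (T + 10 * 2 ^ s) (groverRun M ++ p) μ initState := by
  rw [show T + 10 * 2 ^ s = (T + 10 * (2 ^ s - 1) + 7) + 2 + 1 by
    have := Nat.one_le_two_pow (n := s); omega]
  simp only [groverRun, List.cons_append, List.nil_append]
  rw [haltProb, Gate.apply_had_initState (k := s) (by simpa [Arith.eval] using hs), haltProb_meas]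
  refine Finset.sum_le_sum fun j hj => ?_
  rw [div_pow, one_pow, Real.sq_sqrt (by positivity)]
  refine mul_le_mul_of_nonneg_left ?_ (by positivity)
  have hj : j ≤ 2 ^ s - 1 := by have := Finset.mem_range.1 hj; omega
  have hm : Marked M B (μ.setVar .iter j) = Marked M B μ := by
    funext i; simp [Marked, Mem.setVar]
  have hle : (T + 2) + 10 * j + 1 + 1 ≤ T + 10 * (2 ^ s - 1) + 7 := by omega
  refine le_trans (le_of_eq ?_) (haltProb_mono hle _ _ _)
  rw [haltProb, Gate.apply_had_initState (k := k) (by simpa [Arith.eval, Mem.setVar] using hk),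
    haltProb_iterations (k := k) (by simpa [Mem.setVar] using hμ) (by simpa [Mem.setVar] using hk)
      _ _ (by simp [Mem.setVar]), haltProb_meas, hm, Mem.setVar_setVar]

end Run

/-! ### The success probability of Grover's algorithm -/

section Grover

open Finset

variable {S : ℕ → Prop} {N : ℕ}

theorem sum_groverStep_sq (hN : 0 < N) (v : ℕ → ℝ) :
    ∑ i ∈ range N, groverStep S N v i ^ 2 = ∑ i ∈ range N, v i ^ 2 := by
  classical
  have hN' : (N : ℝ) ≠ 0 := by positivity
  unfold groverStep
  set w : ℕ → ℝ := fun i => if S i then -v i else v i with hw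
  set m := (∑ a ∈ range N, w a) / N with hm
  have h1 : ∑ i ∈ range N, w i = N * m := by rw [hm]; field_simp
  have h2 : ∀ i, v i ^ 2 = w i ^ 2 := fun i => by simp only [hw]; split_ifs <;> ring
  have h3 : ∀ i, (w i - 2 * m) ^ 2 = w i ^ 2 - 4 * m * w i + 4 * m ^ 2 := fun i => by ring
  change ∑ i ∈ range N, (w i - 2 * m) ^ 2 = _
  simp only [h2, h3, sum_add_distrib, sum_sub_distrib, ← mul_sum, h1, sum_const, card_range,
    nsmul_eq_mul]
  ring

/-- The amplitudes after `j` iterations of Grover's algorithm on `N` indices. -/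
noncomputable def groverAmp (S : ℕ → Prop) (N j : ℕ) : ℕ → ℝ :=
  (groverStep S N)^[j] fun _ => 1 / √N

theorem sum_groverAmp_sq (hN : 0 < N) (j : ℕ) : ∑ i ∈ range N, groverAmp S N j i ^ 2 = 1 := by
  have hN' : (N : ℝ) ≠ 0 := by positivity
  induction j with
  | zero => simp [groverAmp, hN']
  | succ j ih => rw [groverAmp, Function.iterate_succ_apply', sum_groverStep_sq hN]; exact ih

open Classical in
/-- The amplitudes rotate by the angle `2 θ` in the plane spanned by the solutions and the other
indices. -/
theorem groverAmp_eq {t : ℕ} (ht : #{i ∈ range N | S i} = t) (h0 : 0 < t) (h1 : t < N) {θ : ℝ}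
    (hs : Real.sin θ = √t / √N) (hc : Real.cos θ = √(N - t) / √N) (j i : ℕ) :
    groverAmp S N j i = (-1) ^ j * (if S i then Real.sin ((2 * j + 1) * θ) / √t
      else Real.cos ((2 * j + 1) * θ) / √(N - t)) := by
  have ht0 : (0 : ℝ) < √t := Real.sqrt_pos.2 (by exact_mod_cast h0)
  have hN0 : (0 : ℝ) < √N := Real.sqrt_pos.2 (by exact_mod_cast h0.trans h1)
  have hd : (0 : ℝ) < N - t := sub_pos.2 (by exact_mod_cast h1)
  have hd0 : (0 : ℝ) < √(N - t) := Real.sqrt_pos.2 hd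
  have ht2 : √(t : ℝ) * √t = t := Real.mul_self_sqrt (by positivity)
  have hN2 : √(N : ℝ) * √N = N := Real.mul_self_sqrt (by positivity)
  have hd2 : √(N - t : ℝ) * √(N - t) = N - t := Real.mul_self_sqrt hd.le
  induction j generalizing i with
  | zero =>
    simp only [groverAmp, Function.iterate_zero, id, pow_zero, one_mul, Nat.cast_zero, mul_zero,
      zero_add, hs, hc]
    split_ifs <;> field_simp
  | succ j ih =>
    set φ := (2 * (j : ℝ) + 1) * θ with hφ
    have hφ' : (2 * ((j + 1 : ℕ) : ℝ) + 1) * θ = (φ + θ) + θ := by rw [hφ]; push_cast; ring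
    have hφs : Real.sin φ = Real.sin (φ + θ) * Real.cos θ - Real.cos (φ + θ) * Real.sin θ := by
      rw [← Real.sin_sub, add_sub_cancel_right]
    have hφc : Real.cos φ = Real.cos (φ + θ) * Real.cos θ + Real.sin (φ + θ) * Real.sin θ := by
      rw [← Real.cos_sub, add_sub_cancel_right]
    have hcard : (#{i ∈ range N | ¬S i} : ℝ) = N - t := by
      rw [filter_not, card_sdiff_of_subset (filter_subset _ _), ht, card_range, Nat.cast_sub h1.le]
    -- the mean after the sign flip
    have hmean : (∑ a ∈ range N, if S a then -groverAmp S N j a else groverAmp S N j a) / N =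
        (-1) ^ j * (Real.cos (φ + θ) / √N) := by
      have : ∀ a, (if S a then -groverAmp S N j a else groverAmp S N j a) =
          if S a then (-1) ^ j * -(Real.sin φ / √t) else (-1) ^ j * (Real.cos φ / √(N - t)) := by
        intro a
        rw [ih]
        split_ifs <;> ring
      simp only [this]
      have aux : ∀ x y z : ℝ, 0 < x → 0 < y → 0 < z → ∀ e a b : ℝ,
          (x * x * (e * -(a / x)) + y * y * (e * (b / y))) / (z * z) =
            e * ((b * (y / z) - a * (x / z)) / z) := by
        intro x y z hx hy hz e a b
        field_simp
        ring
      have := aux _ _ _ ht0 hd0 hN0 ((-1) ^ j) (Real.sin φ) (Real.cos φ)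
      rw [ht2, hd2, hN2] at this
      rw [sum_ite, sum_const, sum_const, nsmul_eq_mul, nsmul_eq_mul, hcard, ht, Real.cos_add, hs,
        hc, this]
    rw [groverAmp, Function.iterate_succ_apply', ← groverAmp, groverStep, hmean, ih, hφ',
      Real.sin_add (φ + θ), Real.cos_add (φ + θ), pow_succ]
    have e1 : √(t : ℝ) / √N / √t = 1 / √N := by field_simp
    have e2 : √(N - t : ℝ) / √N / √(N - t) = 1 / √N := by field_simp
    split_ifs
    · rw [hφs, hs]
      linear_combination (2 * (-1) ^ j * Real.cos (φ + θ)) * e1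
    · rw [hφc, hc]
      linear_combination (2 * (-1) ^ j * Real.cos (φ + θ)) * e2

theorem sum_sin_sq (θ : ℝ) (m : ℕ) :
    4 * Real.sin (2 * θ) * ∑ j ∈ range m, Real.sin ((2 * j + 1) * θ) ^ 2 =
      2 * m * Real.sin (2 * θ) - Real.sin (4 * m * θ) := by
  induction m with
  | zero => simp
  | succ m ih =>
    rw [sum_range_succ, mul_add, ih]
    have h1 : Real.sin (4 * (m + 1 : ℕ) * θ) =
        Real.sin (2 * ((2 * m + 1) * θ) + 2 * θ) := by congr 1; push_cast; ring
    have h2 : Real.sin (4 * m * θ) = Real.sin (2 * ((2 * m + 1) * θ) - 2 * θ) := by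
      congr 1; ring
    rw [h1, h2, Real.sin_add, Real.sin_sub, Real.cos_two_mul ((2 * m + 1) * θ)]
    push_cast
    linear_combination (4 * Real.sin (2 * θ)) * Real.sin_sq_add_cos_sq ((2 * m + 1) * θ)

open Classical in
/-- The probability to measure a solution if the number of iterations is drawn uniformly from
`{0, …, 2 ^ s - 1}`. -/
noncomputable def groverSuccess (S : ℕ → Prop) (N s : ℕ) : ℝ :=
  ∑ j ∈ range (2 ^ s), 1 / 2 ^ s * ∑ i ∈ range N with S i, groverAmp S N j i ^ 2

open Classical in
/-- If `t` of the `N` indices are solutions, then the success probability is at least `1 / 4` at some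
stage `s` with `2 ^ s = O(√(N / t))`. -/
theorem exists_groverSuccess {t : ℕ} (ht : #{i ∈ range N | S i} = t) (h0 : 0 < t) :
    ∃ s, 4 ^ s * t ≤ 4 * N ∧ 1 / 4 ≤ groverSuccess S N s := by
  have htN : t ≤ N := by rw [← ht]; exact (card_filter_le _ _).trans (by simp)
  have hN : 0 < N := h0.trans_le htN
  have hNr : (0 : ℝ) < N := by exact_mod_cast hN
  rcases le_or_gt (3 * N) (4 * t) with hbig | hsmall
  · refine ⟨0, by omega, ?_⟩
    have hbig' : (3 : ℝ) * N ≤ 4 * t := by exact_mod_cast hbig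
    simp [groverSuccess, groverAmp, ht]
    rw [inv_le_iff_one_le_mul₀ (by norm_num), ← div_eq_mul_inv, ← mul_div_right_comm,
      one_le_div hNr]
    linarith
  · have hex : ∃ s, N ≤ 4 ^ s * t := by
      refine ⟨N, ?_⟩
      have : N < 4 ^ N := Nat.lt_pow_self (by norm_num)
      nlinarith
    set s := Nat.find hex with hs
    have hs1 : N ≤ 4 ^ s * t := Nat.find_spec hex
    refine ⟨s, ?_, ?_⟩
    · rcases Nat.eq_zero_or_pos s with h | h
      · rw [h]; omega
      · have := Nat.find_min hex (m := s - 1) (by omega)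
        obtain ⟨r, hr⟩ : ∃ r, s = r + 1 := ⟨s - 1, by omega⟩
        rw [hr, Nat.add_sub_cancel] at this
        rw [hr, pow_succ, mul_comm _ 4, mul_assoc]
        omega
    have h1 : t < N := by omega
    have hd : (0 : ℝ) < N - t := sub_pos.2 (by exact_mod_cast h1)
    have htr : (0 : ℝ) < t := by exact_mod_cast h0
    have hle : √(t : ℝ) / √N ≤ 1 :=
      (div_le_one (Real.sqrt_pos.2 hNr)).2 (Real.sqrt_le_sqrt (by exact_mod_cast htN))
    set θ := Real.arcsin (√t / √N) with hθ
    have hsin : Real.sin θ = √t / √N :=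
      Real.sin_arcsin (by linarith [show 0 ≤ √(t : ℝ) / √N by positivity]) hle
    have hcos : Real.cos θ = √(N - t) / √N := by
      rw [hθ, Real.cos_arcsin, ← Real.sqrt_div hd.le, div_pow, Real.sq_sqrt htr.le,
        Real.sq_sqrt hNr.le]
      congr 1
      field_simp
    have hsucc : groverSuccess S N s =
        1 / 2 ^ s * ∑ j ∈ range (2 ^ s), Real.sin ((2 * j + 1) * θ) ^ 2 := by
      rw [groverSuccess, mul_sum]
      refine sum_congr rfl fun j _ => ?_
      congr 1
      have : ∀ i ∈ {i ∈ range N | S i}, groverAmp S N j i ^ 2 =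
          Real.sin ((2 * j + 1) * θ) ^ 2 / t := by
        intro i hi
        rw [groverAmp_eq ht h0 h1 hsin hcos, if_pos (mem_filter.1 hi).2, mul_pow, ← pow_mul,
          mul_comm j, pow_mul, neg_one_sq, one_pow, one_mul, div_pow, Real.sq_sqrt htr.le]
      rw [sum_congr rfl this, sum_const, ht, nsmul_eq_mul]
      field_simp
    -- the angle is so large that `2 ^ s * sin (2 θ) ≥ 1`
    have hm : 1 ≤ 2 ^ s * Real.sin (2 * θ) := by
      have hpos : 0 ≤ Real.sin (2 * θ) := by rw [Real.sin_two_mul, hsin, hcos]; positivity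
      have hsq : 1 ≤ (2 ^ s * Real.sin (2 * θ)) ^ 2 := by
        have e : (2 ^ s * Real.sin (2 * θ)) ^ 2 = 4 * (4 ^ s * t) * (N - t) / N ^ 2 := by
          rw [Real.sin_two_mul, hsin, hcos]
          have a1 : √(t : ℝ) ^ 2 = t := Real.sq_sqrt htr.le
          have a2 : √(N : ℝ) ^ 2 = N := Real.sq_sqrt hNr.le
          have a3 : √(N - t : ℝ) ^ 2 = N - t := Real.sq_sqrt hd.le
          have a4 : (2 : ℝ) ^ s * 2 ^ s = 4 ^ s := by rw [← mul_pow]; norm_num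
          rw [show (2 ^ s * (2 * (√(t : ℝ) / √N) * (√(N - t) / √N))) ^ 2 =
            4 * ((2 ^ s * 2 ^ s) * √(t : ℝ) ^ 2) * √(N - t) ^ 2 / (√(N : ℝ) ^ 2) ^ 2 by ring,
            a1, a2, a3, a4]
        rw [e, one_le_div (by positivity)]
        have i1 : (N : ℝ) ≤ 4 ^ s * t := by exact_mod_cast hs1
        have i2 : (4 : ℝ) * t ≤ 3 * N := by exact_mod_cast hsmall.le
        calc (N : ℝ) ^ 2 = N * N := sq _
          _ ≤ (4 ^ s * t) * (4 * (N - t)) := by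
            apply mul_le_mul i1 (by linarith) hNr.le (by positivity)
          _ = _ := by ring
      have : (0 : ℝ) ≤ 2 ^ s * Real.sin (2 * θ) := by positivity
      nlinarith
    have hsum := sum_sin_sq θ (2 ^ s)
    have hb := Real.sin_le_one (4 * (2 ^ s : ℕ) * θ)
    have h2s : (0 : ℝ) < 2 ^ s := by positivity
    have hpos : 0 < Real.sin (2 * θ) := by
      by_contra h
      nlinarith [mul_nonpos_of_nonneg_of_nonpos h2s.le (not_lt.1 h)]
    rw [hsucc, one_div_mul_eq_div, div_le_div_iff₀ (by norm_num) h2s]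
    push_cast at hsum hb
    rw [one_mul]
    refine le_of_mul_le_mul_left ?_ hpos
    nlinarith

end Grover

/-! ### Grover's search -/

/-- The memories agree in all arrays and in the variables of the list `K`. -/
def Agree (K : List Var) (μ μ' : Mem) : Prop :=
  μ'.arrs = μ.arrs ∧ ∀ x ∈ K, μ'.vars x = μ.vars x

section Agree

variable {K K' : List Var} {μ μ' μ'' : Mem}

theorem Agree.refl : Agree K μ μ := ⟨rfl, fun _ _ => rfl⟩

theorem Agree.trans (h : Agree K μ μ') (h' : Agree K μ' μ'') : Agree K μ μ'' :=
  ⟨h'.1.trans h.1, fun x hx => (h'.2 x hx).trans (h.2 x hx)⟩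

theorem Agree.mono (h : Agree K μ μ') (hK : K' ⊆ K) : Agree K' μ μ' :=
  ⟨h.1, fun x hx => h.2 x (hK hx)⟩

theorem Agree.setVar (h : Agree K μ μ') {x : Var} (hx : x ∉ K) (a : ℕ) :
    Agree K μ (μ'.setVar x a) :=
  ⟨h.1, fun w hw => by
    rw [← h.2 w hw]
    exact Function.update_of_ne (ne_of_mem_of_not_mem hw hx) _ _⟩

@[simp] theorem Mem.setVar_arrs (x : Var) (a : ℕ) : (μ.setVar x a).arrs = μ.arrs := rfl

@[simp] theorem Mem.setVar_self (x : Var) (a : ℕ) : (μ.setVar x a).vars x = a := by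
  simp [Mem.setVar]

end Agree

/-- The variables that a search leaves unchanged. -/
def searchVars : List Var := [.size, .head, .tail, .cur, .bits, .reps]

/-- The variables that a stage of a search leaves unchanged before `stage` is increased. -/
def stageVars : List Var := .stage :: searchVars

section Search

variable {B : BlackBox} {good : Mem → Prop} {M : Model} {μ μ' : Mem}

theorem prob_set {x : Var} {e : Arith} {c : List Cmd} {T : ℝ} (hT : 0 ≤ T) :
    prob B good (T + 1) (.set x e :: c) μ = prob B good T c (μ.setVar x (e.eval μ)) := by
  rw [prob, Nat.floor_add_one hT, haltProb, prob]

theorem prob_loop_pos {s : Test} {c p : List Cmd} {T : ℝ} (hT : 0 ≤ T) (hs : s.holds μ) :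
    prob B good (T + 1) (.loop s c :: p) μ = prob B good T (c ++ .loop s c :: p) μ := by
  rw [prob, Nat.floor_add_one hT, haltProb, if_pos hs, prob]

theorem prob_loop_neg {s : Test} {c p : List Cmd} {T : ℝ} (hT : 0 ≤ T) (hs : ¬s.holds μ) :
    prob B good (T + 1) (.loop s c :: p) μ = prob B good T p μ := by
  rw [prob, Nat.floor_add_one hT, haltProb, if_neg hs, prob]

theorem marked_congr {K : List Var} (h : Agree K μ μ') (h1 : .size ∈ K) (h2 : .cur ∈ K) :
    Marked M B μ' = Marked M B μ := by
  funext i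
  rw [Marked, Marked, h.1, h.2 _ h1, h.2 _ h2]

/-- In `μ'` a search from `μ` has found an undiscovered neighbour. -/
def Found (M : Model) (B : BlackBox) (μ μ' : Mem) : Prop :=
  μ'.vars .found = 1 ∧
    ∃ i, Marked M B μ i ∧ μ'.vars .y = target M B (μ.vars .size) (μ.vars .cur) i

theorem Found.congr {ν : Mem} {K : List Var} (h : Agree K μ ν) (h1 : .size ∈ K) (h2 : .cur ∈ K)
    (hf : Found M B ν μ') : Found M B μ μ' := by
  rw [Found, marked_congr h h1 h2, h.2 _ h1, h.2 _ h2] at hf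
  exact hf

open Classical in
/-- The check of a measured index recognizes the solutions. -/
theorem ens_check {K : List Var} (hK : ∀ x ∈ [Var.y, .z, .found], x ∉ K)
    (hμ : μ.arrs .lay (μ.vars .size) ≠ μ.vars .size) (hf : μ.vars .found = 0) :
    Ens B good 1 4 (check M) μ fun μ' => Agree K μ μ' ∧
      if Marked M B μ (μ.vars .i) then Found M B μ μ' else μ'.vars .found = 0 := by
  have hy := hK .y (by simp)
  have hz := hK .z (by simp)
  have hfo := hK .found (by simp)
  cases M
  · refine Ens.mono (t := 0 + 1 + 1 + 1 + 1) (Ens.ask (Ens.set ?_)) le_rfl (by norm_num)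
      (fun _ h => h)
    by_cases h : B.entry (μ.vars .cur) (μ.vars .i) = 1 ∧ μ.arrs .lay (μ.vars .i) = μ.vars .size
    · have hm : Marked .adjacency B μ (μ.vars .i) := by simp [Marked, target, h.1, h.2]
      simp only [if_pos hm]
      refine Ens.cond_pos (by simpa [Test.holds, Arith.eval, Mem.setVar] using h) (Ens.set
        (Ens.nil ⟨((Agree.refl.setVar hz _).setVar hy _).setVar hfo _, ?_, _, hm, ?_⟩))
      · simp [Arith.eval]
      · simp [Arith.eval, Mem.setVar, target, h.1]
    · have hm : ¬Marked .adjacency B μ (μ.vars .i) := by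
        by_cases h1 : B.entry (μ.vars .cur) (μ.vars .i) = 1
        · simpa [Marked, target, h1] using h
        · simpa [Marked, target, h1] using hμ
      simp only [if_neg hm]
      refine (Ens.cond_neg (by simpa [Test.holds, Arith.eval, Mem.setVar] using h)
        (Ens.nil ⟨(Agree.refl.setVar hz _).setVar hy _, ?_⟩)).mono le_rfl (by norm_num)
          (fun _ h => h)
      simpa [Mem.setVar] using hf
  · refine Ens.mono (t := 0 + 1 + 1 + 1) (Ens.ask ?_) le_rfl (by norm_num) (fun _ h => h)
    by_cases hm : Marked .list B μ (μ.vars .i)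
    · simp only [if_pos hm]
      refine Ens.cond_pos (by simpa [Test.holds, Arith.eval, Mem.setVar, Marked, target] using hm) (Ens.set
        (Ens.nil ⟨(Agree.refl.setVar hy _).setVar hfo _, ?_, _, hm, ?_⟩))
      · simp [Arith.eval]
      · simp [Arith.eval, Mem.setVar, target]
    · simp only [if_neg hm]
      refine (Ens.cond_neg (by simpa [Test.holds, Arith.eval, Mem.setVar, Marked, target] using hm)
        (Ens.nil ⟨Agree.refl.setVar hy _, ?_⟩)).mono le_rfl (by norm_num)
          (fun _ h => h)
      simpa [Mem.setVar] using hf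

/-- A run of Grover's algorithm finds a solution with probability `groverSuccess`. -/
theorem prob_groverRun {k s : ℕ} (hμ : μ.arrs .lay (μ.vars .size) ≠ μ.vars .size)
    (hk : μ.vars .bits = k) (hs : μ.vars .stage = s) (hf : μ.vars .found = 0) {p : List Cmd}
    {T q₀ q₁ : ℝ} (hT : 0 ≤ T) (h0 : 0 ≤ q₀) (h01 : q₀ ≤ q₁)
    (h₁ : ∀ μ', Agree (.rep :: stageVars) μ μ' → Found M B μ μ' → q₁ ≤ prob B good T p μ')
    (h₀ : ∀ μ', Agree (.rep :: stageVars) μ μ' → μ'.vars .found = 0 → q₀ ≤ prob B good T p μ') :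
    q₀ + groverSuccess (Marked M B μ) (2 ^ k) s * (q₁ - q₀) ≤
      prob B good (T + (10 * 2 ^ s + 4)) (groverRun M ++ p) μ := by
  classical
  have hfl : ⌊T + (10 * 2 ^ s + 4)⌋₊ = ⌊T + 4⌋₊ + 10 * 2 ^ s := by
    rw [← Nat.floor_add_natCast (by positivity)]
    congr 1
    push_cast
    ring
  rw [prob, hfl]
  refine le_trans ?_ (haltProb_groverRun hμ hk hs _ _)
  set A : ℕ → ℕ → ℝ := groverAmp (Marked M B μ) (2 ^ k) with hA
  have hA' : ∀ j, (groverStep (Marked M B μ) (2 ^ k))^[j] (fun _ => 1 / √(2 ^ k)) = A j := by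
    intro j
    rw [hA, groverAmp]
    push_cast
    rfl
  simp only [hA']
  -- the value of a measured index
  have val : ∀ i, q₀ + (if Marked M B μ i then q₁ - q₀ else 0) ≤
      haltProb B good ⌊T + 4⌋₊ (check M ++ p) ((μ.setVar .iter 0).setVar .i i) initState := by
    intro i
    set ν := (μ.setVar .iter 0).setVar .i i
    have hag : Agree (.rep :: stageVars) μ ν :=
      (Agree.refl.setVar (by decide) _).setVar (by decide) _
    have hm : Marked M B ν = Marked M B μ := marked_congr hag (by decide) (by decide)
    have hi : ν.vars .i = i := Mem.setVar_self _ _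
    have := (ens_check (M := M) (B := B) (good := good) (μ := ν) (K := .rep :: stageVars)
      (by decide) hμ hf).2 p T
    rw [hm, hi] at this
    by_cases h : Marked M B μ i
    · simp only [if_pos h, one_mul] at this ⊢
      refine (add_sub_cancel q₀ q₁).le.trans (this q₁ hT (h0.trans h01) fun μ' h' => ?_)
      exact h₁ μ' (hag.trans h'.1) (h'.2.congr hag (by decide) (by decide))
    · simp only [if_neg h, one_mul, add_zero] at this ⊢
      exact this q₀ hT h0 fun μ' h' => h₀ μ' (hag.trans h'.1) h'.2
  refine le_trans (le_of_eq ?_) (Finset.sum_le_sum fun j _ => mul_le_mul_of_nonneg_left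
    (Finset.sum_le_sum fun i _ => mul_le_mul_of_nonneg_left (val i) (sq_nonneg (A j i)))
    (by positivity))
  have e1 : ∀ j, ∑ i ∈ Finset.range (2 ^ k), A j i ^ 2 *
      (q₀ + (if Marked M B μ i then q₁ - q₀ else 0)) =
      q₀ + (∑ i ∈ Finset.range (2 ^ k) with Marked M B μ i, A j i ^ 2) * (q₁ - q₀) := by
    intro j
    simp only [mul_add, Finset.sum_add_distrib, ← Finset.sum_mul, hA]
    rw [sum_groverAmp_sq (by positivity), one_mul, Finset.sum_filter, Finset.sum_mul]
    congr 1
    exact Finset.sum_congr rfl fun i _ => by split_ifs <;> simp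
  simp only [e1]
  simp only [mul_add, Finset.sum_add_distrib, groverSuccess]
  rw [Finset.sum_mul]
  congr 1
  · rw [Finset.sum_const, Finset.card_range, nsmul_eq_mul]
    push_cast
    field_simp
  · exact Finset.sum_congr rfl fun j _ => by rw [mul_assoc]

theorem groverSuccess_le_one (S : ℕ → Prop) {N : ℕ} (hN : 0 < N) (s : ℕ) :
    groverSuccess S N s ≤ 1 := by
  classical
  calc groverSuccess S N s ≤ ∑ j ∈ Finset.range (2 ^ s), 1 / 2 ^ s * (1 : ℝ) := by
        refine Finset.sum_le_sum fun j _ => mul_le_mul_of_nonneg_left ?_ (by positivity)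
        rw [← sum_groverAmp_sq (S := S) hN j]
        exact Finset.sum_le_sum_of_subset_of_nonneg (Finset.filter_subset _ _)
          fun _ _ _ => sq_nonneg _
    _ = 1 := by
        rw [Finset.sum_const, Finset.card_range, nsmul_eq_mul]
        push_cast
        field_simp

theorem groverSuccess_nonneg (S : ℕ → Prop) (N s : ℕ) : 0 ≤ groverSuccess S N s := by
  classical
  exact Finset.sum_nonneg fun _ _ =>
    mul_nonneg (by positivity) (Finset.sum_nonneg fun _ _ => sq_nonneg _)

/-- The loop over the runs of a stage. -/
def repLoop (M : Model) : Cmd :=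
  .loop (.both (.eq (.var .found) (.lit 0)) (.lt (.var .rep) (.var .reps)))
    (groverRun M ++ [incr .rep])

/-- If a run fails with probability `1 - σ`, then `r` runs all fail with probability `(1 - σ) ^ r`. Here
`q₁` and `q₀` bound the value of the continuation after success and after failure. -/
theorem prob_repLoop {μ₀ : Mem} {k s : ℕ} (hμ : μ₀.arrs .lay (μ₀.vars .size) ≠ μ₀.vars .size)
    (hk : μ₀.vars .bits = k) (hs : μ₀.vars .stage = s) {p : List Cmd} {T q₀ q₁ : ℝ} (hT : 0 ≤ T)
    (h0 : 0 ≤ q₀) (h01 : q₀ ≤ q₁)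
    (h₁ : ∀ μ', Agree stageVars μ₀ μ' → Found M B μ₀ μ' → q₁ ≤ prob B good T p μ')
    (h₀ : ∀ μ', Agree stageVars μ₀ μ' → μ'.vars .found = 0 → q₀ ≤ prob B good T p μ')
    (r : ℕ) (μ : Mem) (hag : Agree stageVars μ₀ μ) (hf : μ.vars .found = 0)
    (hr : μ.vars .reps - μ.vars .rep = r) :
    q₁ - (1 - groverSuccess (Marked M B μ₀) (2 ^ k) s) ^ r * (q₁ - q₀) ≤
      prob B good (T + (r * (10 * 2 ^ s + 6) + 1)) (repLoop M :: p) μ := by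
  have hσ1 := groverSuccess_le_one (Marked M B μ₀) (N := 2 ^ k) (by positivity) s
  have hσ0 := groverSuccess_nonneg (Marked M B μ₀) (2 ^ k) s
  have hm : Marked M B μ = Marked M B μ₀ := marked_congr hag (by decide) (by decide)
  induction r generalizing μ with
  | zero =>
    rw [show T + ((0 : ℕ) * (10 * 2 ^ s + 6) + 1) = T + 1 by simp, repLoop,
      prob_loop_neg hT (by simp [Test.holds, Arith.eval]; omega)]
    simpa using h₀ μ hag hf
  | succ r ih =>
    set σ := groverSuccess (Marked M B μ₀) (2 ^ k) s with hσ
    have ht : 0 ≤ T + ((r : ℝ) * (10 * 2 ^ s + 6) + 1) := by positivity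
    rw [show T + ((r + 1 : ℕ) * (10 * 2 ^ s + 6) + 1) =
      (T + (r * (10 * 2 ^ s + 6) + 1)) + 1 + (10 * 2 ^ s + 4) + 1 by push_cast; ring, repLoop,
      prob_loop_pos (by positivity) (by simp [Test.holds, Arith.eval]; omega), List.append_assoc,
      ← repLoop]
    have hpow : 0 ≤ (1 - σ) ^ r := pow_nonneg (by linarith) _
    have hpow1 : (1 - σ) ^ r ≤ 1 := pow_le_one₀ (by linarith) (by linarith)
    refine le_trans (le_of_eq ?_) (prob_groverRun (M := M) (k := k) (s := s)
      (q₀ := q₁ - (1 - σ) ^ r * (q₁ - q₀)) (q₁ := q₁) (by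
        rw [hag.1, hag.2 _ (by decide)]; exact hμ) ((hag.2 _ (by decide)).trans hk)
      ((hag.2 _ (by decide)).trans hs) hf (by positivity) (by nlinarith) (by nlinarith) ?_ ?_)
    · rw [hm, ← hσ]; ring
    · intro μ' hag' hf'
      have hag'' : Agree stageVars μ₀ (μ'.setVar .rep (μ'.vars .rep + 1)) :=
        (hag.trans (hag'.mono (by decide))).setVar (by decide) _
      have hf'' := hf'.congr hag (by decide) (by decide)
      rw [List.cons_append, List.nil_append, incr, prob_set ht]
      refine le_trans ?_ (prob_mono (show T + 1 ≤ _ by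
        have : (0 : ℝ) ≤ r * (10 * 2 ^ s + 6) := by positivity
        linarith) _ _)
      rw [repLoop, prob_loop_neg hT (by simp [Test.holds, Arith.eval, Mem.setVar, hf'.1])]
      exact h₁ _ hag'' ⟨by simpa [Mem.setVar] using hf''.1,
        by simpa [Arith.eval, Mem.setVar] using hf''.2⟩
    · intro μ' hag' hf'
      have hag'' : Agree stageVars μ₀ (μ'.setVar .rep (μ'.vars .rep + 1)) :=
        (hag.trans (hag'.mono (by decide))).setVar (by decide) _
      rw [List.cons_append, List.nil_append, incr, prob_set ht]
      refine ih _ hag'' ?_ ?_ (marked_congr hag'' (by decide) (by decide))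
      · simpa [Mem.setVar] using hf'
      · have e1 : μ'.vars .reps = μ.vars .reps := hag'.2 _ (by decide)
        have e2 : μ'.vars .rep = μ.vars .rep := hag'.2 _ (by decide)
        simp [Arith.eval, Mem.setVar, e1, e2]
        omega

/-- The instructions of one stage of a search. -/
def stageBody (M : Model) : List Cmd := [.set .rep (.lit 0), repLoop M, incr .stage]

/-- A stage of `R` runs takes `O(R * 2 ^ s)` steps. With certainty it ends with a solution or with
nothing found; if a run succeeds with probability at least `1 / 4`, it ends with a solution with
probability at least `1 - (3 / 4) ^ R`. -/
theorem ens_stageBody {δ : ℝ} {Q : Mem → Prop} {k s R : ℕ}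
    (hμ : μ.arrs .lay (μ.vars .size) ≠ μ.vars .size)
    (hk : μ.vars .bits = k) (hs : μ.vars .stage = s) (hR : μ.vars .reps = R)
    (hf : μ.vars .found = 0)
    (H : (δ = 1 ∧ ∀ μ', Agree searchVars μ μ' → μ'.vars .stage = s + 1 →
        (Found M B μ μ' ∨ μ'.vars .found = 0) → Q μ') ∨
      (1 / 4 ≤ groverSuccess (Marked M B μ) (2 ^ k) s ∧ δ = 1 - (3 / 4) ^ R ∧
        ∀ μ', Agree searchVars μ μ' → Found M B μ μ' → Q μ')) :
    Ens B good δ (R * (10 * 2 ^ s + 6) + 3) (stageBody M) μ Q := by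
  refine ⟨by positivity, fun p T q hT hq hQ => ?_⟩
  have ht : 0 ≤ T + 1 + ((R : ℝ) * (10 * 2 ^ s + 6) + 1) := by positivity
  rw [show T + (R * (10 * 2 ^ s + 6) + 3) = T + 1 + (R * (10 * 2 ^ s + 6) + 1) + 1 by ring,
    stageBody, List.cons_append, prob_set ht]
  simp only [Arith.eval, List.cons_append, List.nil_append]
  set ν := μ.setVar .rep 0
  have hag : Agree stageVars μ ν := Agree.refl.setVar (by decide) _
  have key : ∀ μ', Agree stageVars ν μ' →
      Agree searchVars μ (μ'.setVar .stage (μ'.vars .stage + 1)) := fun μ' h =>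
    ((hag.trans h).mono (by decide)).setVar (by decide) _
  have found : ∀ μ', Found M B ν μ' →
      Found M B μ (μ'.setVar .stage (μ'.vars .stage + 1)) := fun μ' h => by
    have := h.congr hag (by decide) (by decide)
    exact ⟨by simpa [Mem.setVar] using this.1, by simpa [Mem.setVar] using this.2⟩
  have hm : Marked M B ν = Marked M B μ := marked_congr hag (by decide) (by decide)
  have hT1 : 0 ≤ T + 1 := by positivity
  have hRr : ν.vars .reps - ν.vars .rep = R := by simp [ν, Mem.setVar, hR]
  rcases H with ⟨rfl, H⟩ | ⟨hσ, rfl, H⟩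
  · have := prob_repLoop (M := M) (B := B) (good := good) (μ₀ := ν) (k := k) (s := s)
      (p := incr .stage :: p) (q₀ := q) (q₁ := q) hμ hk hs hT1 hq le_rfl ?_ ?_ R ν Agree.refl hf hRr
    · simpa using this
    · intro μ' h1 h2
      rw [incr, prob_set hT]
      refine hQ _ (H _ (key _ h1) ?_ (Or.inl (found _ h2)))
      simp [Arith.eval, h1.2 .stage (by decide), ν, Mem.setVar, hs]
    · intro μ' h1 h2
      rw [incr, prob_set hT]
      refine hQ _ (H _ (key _ h1) ?_ (Or.inr (by simpa [Mem.setVar] using h2)))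
      simp [Arith.eval, h1.2 .stage (by decide), ν, Mem.setVar, hs]
  · have := prob_repLoop (M := M) (B := B) (good := good) (μ₀ := ν) (k := k) (s := s)
      (p := incr .stage :: p) (q₀ := 0) (q₁ := q) hμ hk hs hT1 le_rfl hq ?_ ?_ R ν Agree.refl hf hRr
    · refine le_trans ?_ this
      have h1 := groverSuccess_le_one (Marked M B μ) (N := 2 ^ k) (by positivity) s
      have h2 : (1 - groverSuccess (Marked M B μ) (2 ^ k) s) ^ R ≤ (3 / 4 : ℝ) ^ R :=
        pow_le_pow_left₀ (by linarith) (by linarith) _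
      rw [hm]
      nlinarith
    · intro μ' h1 h2
      rw [incr, prob_set hT]
      exact hQ _ (H _ (key _ h1) (found _ h2))
    · exact fun μ' _ _ => prob_nonneg _ _ _

/-- The loop over the stages of a search. -/
def stageLoop (M : Model) : Cmd :=
  .loop (.both (.eq (.var .found) (.lit 0))
    (.lt (.plus (.var .stage) (.var .stage)) (.plus (.var .bits) (.lit 3)))) (stageBody M)

theorem search_eq (M : Model) :
    search M = [.set .found (.lit 0), .set .stage (.lit 0), stageLoop M] := rfl

/-- If stage `S` is good, then the search succeeds there at the latest. -/
theorem ens_stageLoop_found {μ₀ : Mem} {k S R : ℕ}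
    (hμ : μ₀.arrs .lay (μ₀.vars .size) ≠ μ₀.vars .size) (hk : μ₀.vars .bits = k)
    (hR : μ₀.vars .reps = R) (hR1 : 1 ≤ R) (hS : 2 * S ≤ k + 2)
    (hσ : 1 / 4 ≤ groverSuccess (Marked M B μ₀) (2 ^ k) S) (d : ℕ) (hd : d ≤ S) (μ : Mem)
    (hag : Agree searchVars μ₀ μ) (hs : μ.vars .stage = S - d) (hf : μ.vars .found = 0) :
    Ens B good (1 - (3 / 4) ^ R) (20 * R * (2 * 2 ^ S - 2 ^ (S - d)) + 1) [stageLoop M] μ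
      fun μ' => Agree searchVars μ₀ μ' ∧ Found M B μ₀ μ' := by
  have hpos : (0 : ℝ) ≤ 1 - (3 / 4) ^ R := by
    have : (3 / 4 : ℝ) ^ R ≤ 1 := pow_le_one₀ (by norm_num) (by norm_num)
    linarith
  have hle : 1 - (3 / 4 : ℝ) ^ R ≤ 1 := by
    have : (0 : ℝ) ≤ (3 / 4) ^ R := by positivity
    linarith
  have hR1' : (1 : ℝ) ≤ R := by exact_mod_cast hR1
  have hμ' : μ.arrs .lay (μ.vars .size) ≠ μ.vars .size := by
    rw [hag.1, hag.2 _ (by decide)]; exact hμ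
  have hk' : μ.vars .bits = k := (hag.2 _ (by decide)).trans hk
  have hR' : μ.vars .reps = R := (hag.2 _ (by decide)).trans hR
  have hm : Marked M B μ = Marked M B μ₀ := marked_congr hag (by decide) (by decide)
  have exit : ∀ μ', Agree searchVars μ μ' → Found M B μ μ' → Ens B good 1 1 [stageLoop M] μ'
      fun μ' => Agree searchVars μ₀ μ' ∧ Found M B μ₀ μ' := fun μ' h1 h2 =>
    (Ens.loop_neg (by simp [Test.holds, Arith.eval, h2.1]) (Ens.nil
      ⟨hag.trans h1, h2.congr hag (by decide) (by decide)⟩)).mono le_rfl (by norm_num) fun _ h => h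
  have enter : (Test.both (.eq (.var .found) (.lit 0))
      (.lt (.plus (.var .stage) (.var .stage)) (.plus (.var .bits) (.lit 3)))).holds μ := by
    simp [Test.holds, Arith.eval, hf, hs, hk']; omega
  induction d generalizing μ with
  | zero =>
    refine Ens.mono (Ens.loop_pos enter (Ens.seq (ens_stageBody (δ := 1 - (3 / 4) ^ R) (R := R)
      hμ' hk' hs hR' hf (Or.inr ⟨by rw [hm]; simpa using hσ, rfl, fun μ' h1 h2 => And.intro h1 h2⟩))
      zero_le_one (fun μ' h => exit μ' h.1 h.2) zero_le_one)) (by simp) ?_ fun _ h => h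
    have h2 : (1 : ℝ) ≤ 2 ^ S := one_le_pow₀ (by norm_num)
    simp only [Nat.sub_zero]
    nlinarith [mul_le_mul hR1' h2 zero_le_one (by linarith)]
  | succ d ih =>
    have hs1 : S - (d + 1) + 1 = S - d := by omega
    have h2 : (1 : ℝ) ≤ 2 ^ (S - (d + 1)) := one_le_pow₀ (by norm_num)
    have h3 : (2 : ℝ) ^ (S - d) = 2 ^ (S - (d + 1)) * 2 := by rw [← hs1, pow_succ]
    have h4 : (2 : ℝ) ^ (S - d) ≤ 2 ^ S := pow_le_pow_right₀ (by norm_num) (by omega)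
    have h5 : (0 : ℝ) ≤ 20 * R * (2 * 2 ^ S - 2 ^ (S - d)) :=
      mul_nonneg (by positivity) (by linarith)
    refine Ens.mono (Ens.loop_pos enter (Ens.seq_one (ens_stageBody (δ := 1) (R := R)
      hμ' hk' hs hR' hf (Or.inl ⟨rfl, fun μ' h1 h2 h3 => And.intro h1 (And.intro h2 h3)⟩))
      (δ := 1 - (3 / 4) ^ R) (t' := 20 * R * (2 * 2 ^ S - 2 ^ (S - d)) + 1)
      (fun μ' h => ?_) (by linarith) hpos)) le_rfl ?_ fun _ h => h
    · obtain ⟨h1, h2, h3 | h3⟩ := h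
      · exact (exit μ' h1 h3).mono hle (by linarith) fun _ h => h
      · have hag' := hag.trans h1
        have hs' : μ'.vars .stage = S - d := by omega
        have hk'' : μ'.vars .bits = k := (hag'.2 _ (by decide)).trans hk
        refine ih (by omega) μ' hag' hs' h3 ?_ hk''
          ((hag'.2 _ (by decide)).trans hR) (marked_congr hag' (by decide) (by decide)) ?_ ?_
        · rw [hag'.1, hag'.2 _ (by decide)]; exact hμ
        · intro μ'' h4 h5
          exact (Ens.loop_neg (by simp [Test.holds, Arith.eval, h5.1]) (Ens.nil
            ⟨hag'.trans h4, h5.congr hag' (by decide) (by decide)⟩)).mono le_rfl (by norm_num)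
              fun _ h => h
        · simp [Test.holds, Arith.eval, h3, hs', hk'']; omega
    · nlinarith [mul_le_mul hR1' h2 zero_le_one (by linarith)]

/-- Without solutions the search goes through all stages and finds nothing. -/
theorem ens_stageLoop_none {μ₀ : Mem} {k S R : ℕ}
    (hμ : μ₀.arrs .lay (μ₀.vars .size) ≠ μ₀.vars .size) (hk : μ₀.vars .bits = k)
    (hR : μ₀.vars .reps = R) (hR1 : 1 ≤ R) (hS : 2 * S = k + 2 ∨ 2 * S = k + 1)
    (hno : ∀ i, ¬Marked M B μ₀ i) (d : ℕ) (hd : d ≤ S + 1) (μ : Mem)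
    (hag : Agree searchVars μ₀ μ) (hs : μ.vars .stage = S + 1 - d) (hf : μ.vars .found = 0) :
    Ens B good 1 (20 * R * (2 * 2 ^ S - 2 ^ (S + 1 - d)) + 1) [stageLoop M] μ
      fun μ' => Agree searchVars μ₀ μ' ∧ μ'.vars .found = 0 := by
  have hR1' : (1 : ℝ) ≤ R := by exact_mod_cast hR1
  have hk' : μ.vars .bits = k := (hag.2 _ (by decide)).trans hk
  induction d generalizing μ with
  | zero =>
    refine (Ens.loop_neg ?_ (Ens.nil ⟨hag, hf⟩)).mono le_rfl ?_ fun _ h => h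
    · simp [Test.holds, Arith.eval, hs, hk']; omega
    · simp [pow_succ, mul_comm]
  | succ d ih =>
    have hs1 : S + 1 - (d + 1) + 1 = S + 1 - d := by omega
    have h2 : (1 : ℝ) ≤ 2 ^ (S + 1 - (d + 1)) := one_le_pow₀ (by norm_num)
    have h3 : (2 : ℝ) ^ (S + 1 - d) = 2 ^ (S + 1 - (d + 1)) * 2 := by rw [← hs1, pow_succ]
    have h4 : (2 : ℝ) ^ (S + 1 - d) ≤ 2 * 2 ^ S := by
      rw [mul_comm, ← pow_succ]; exact pow_le_pow_right₀ (by norm_num) (by omega)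
    have h5 : (0 : ℝ) ≤ 20 * R * (2 * 2 ^ S - 2 ^ (S + 1 - d)) :=
      mul_nonneg (by positivity) (by linarith)
    have hm : Marked M B μ = Marked M B μ₀ := marked_congr hag (by decide) (by decide)
    refine Ens.mono (Ens.loop_pos ?_ (Ens.seq_one (ens_stageBody (δ := 1) (R := R) ?_ hk' hs
      ((hag.2 _ (by decide)).trans hR) hf
      (Or.inl ⟨rfl, fun μ' h1 h2 h3 => And.intro h1 (And.intro h2 h3)⟩))
      (δ := 1) (t' := 20 * R * (2 * 2 ^ S - 2 ^ (S + 1 - d)) + 1)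
      (fun μ' h => ?_) (by linarith) zero_le_one)) le_rfl ?_ fun _ h => h
    · simp [Test.holds, Arith.eval, hf, hs, hk']; omega
    · rw [hag.1, hag.2 _ (by decide)]; exact hμ
    · obtain ⟨h1, h2, h3 | h3⟩ := h
      · obtain ⟨-, i, hi, -⟩ := h3
        exact absurd (hm ▸ hi) (hno i)
      · have hag' := hag.trans h1
        exact ih (by omega) μ' hag' (by omega) h3 ((hag'.2 _ (by decide)).trans hk)
    · nlinarith [mul_le_mul hR1' h2 zero_le_one (by linarith)]

open Classical in
/-- A search with `t ≥ 1` solutions succeeds with high probability in time `O(R √(2 ^ k / t))`. -/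
theorem ens_search_found {k R t : ℕ} (hμ : μ.arrs .lay (μ.vars .size) ≠ μ.vars .size)
    (hk : μ.vars .bits = k) (hR : μ.vars .reps = R) (hR1 : 1 ≤ R) (ht : 1 ≤ t)
    (hcard : t ≤ ((Finset.range (2 ^ k)).filter (Marked M B μ)).card) :
    Ens B good (1 - (3 / 4) ^ R) (80 * R * (√(2 ^ k) / √t)) (search M) μ
      fun μ' => Agree searchVars μ μ' ∧ Found M B μ μ' := by
  obtain ⟨S, hS, hσ⟩ := exists_groverSuccess (S := Marked M B μ) (N := 2 ^ k) rfl (ht.trans hcard)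
  have hS' : 4 ^ S * t ≤ 4 * 2 ^ k := (Nat.mul_le_mul_left _ hcard).trans hS
  have hS2 : 2 * S ≤ k + 2 := by
    have h1 : 4 ^ S ≤ 4 * 2 ^ k := (Nat.le_mul_of_pos_right _ ht).trans hS'
    rw [show (4 : ℕ) = 2 ^ 2 by norm_num, ← pow_mul, ← pow_add] at h1
    have := (Nat.pow_le_pow_iff_right (by norm_num)).1 h1
    omega
  set ν := (μ.setVar .found 0).setVar .stage 0 with hν
  have hag : Agree searchVars μ ν := (Agree.refl.setVar (by decide) _).setVar (by decide) _
  have hm : Marked M B ν = Marked M B μ := marked_congr hag (by decide) (by decide)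
  have hloop := ens_stageLoop_found (M := M) (B := B) (good := good) (μ₀ := ν) (k := k) (S := S)
    (R := R) hμ hk hR hR1 hS2 (by rw [hm]; exact hσ) S le_rfl ν Agree.refl
    (by simp [ν, Mem.setVar]) (by simp [ν, Mem.setVar])
  rw [search_eq]
  refine (Ens.set (Ens.set hloop)).mono le_rfl ?_ fun μ' h =>
    ⟨hag.trans h.1, h.2.congr hag (by decide) (by decide)⟩
  have hR1' : (1 : ℝ) ≤ R := by exact_mod_cast hR1
  have ht' : (0 : ℝ) < √t := Real.sqrt_pos.2 (by exact_mod_cast ht)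
  have hb : (2 : ℝ) ^ S ≤ 2 * (√(2 ^ k) / √t) := by
    rw [← mul_div_assoc, le_div_iff₀ ht']
    refine le_of_sq_le_sq ?_ (by positivity)
    rw [mul_pow, mul_pow, Real.sq_sqrt (by positivity), Real.sq_sqrt (by positivity), ← pow_mul,
      mul_comm S, pow_mul]
    norm_num
    exact_mod_cast hS'
  rw [Nat.sub_self, pow_zero]
  nlinarith

/-- A search without solutions ends in time `O(R √(2 ^ k))`. -/
theorem ens_search_none {k R : ℕ} (hμ : μ.arrs .lay (μ.vars .size) ≠ μ.vars .size)
    (hk : μ.vars .bits = k) (hR : μ.vars .reps = R) (hR1 : 1 ≤ R)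
    (hno : ∀ i, ¬Marked M B μ i) :
    Ens B good 1 (80 * R * √(2 ^ k)) (search M) μ
      fun μ' => Agree searchVars μ μ' ∧ μ'.vars .found = 0 := by
  set S := (k + 2) / 2 with hS
  set ν := (μ.setVar .found 0).setVar .stage 0 with hν
  have hag : Agree searchVars μ ν := (Agree.refl.setVar (by decide) _).setVar (by decide) _
  have hm : Marked M B ν = Marked M B μ := marked_congr hag (by decide) (by decide)
  have hloop := ens_stageLoop_none (M := M) (B := B) (good := good) (μ₀ := ν) (k := k) (S := S)
    (R := R) hμ hk hR hR1 (by omega) (by rw [hm]; exact hno) (S + 1) le_rfl ν Agree.refl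
    (by simp [ν, Mem.setVar]) (by simp [ν, Mem.setVar])
  rw [search_eq]
  refine (Ens.set (Ens.set hloop)).mono le_rfl ?_ fun μ' h => ⟨hag.trans h.1, h.2⟩
  have hR1' : (1 : ℝ) ≤ R := by exact_mod_cast hR1
  have hb : (2 : ℝ) ^ S ≤ 2 * √(2 ^ k) := by
    refine le_of_sq_le_sq ?_ (by positivity)
    rw [mul_pow, Real.sq_sqrt (by positivity), ← pow_mul, show (2 : ℝ) ^ 2 * 2 ^ k = 2 ^ (k + 2) by
      rw [pow_add]; ring]
    exact pow_le_pow_right₀ (by norm_num) (by omega)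
  rw [Nat.sub_self, pow_zero]
  nlinarith

end Search

/-! ### The invariant of breadth-first search -/

/-- The state of breadth-first search with layer numbers `lay` (where `n` stands for `∞`) and queue
`q h, …, q (t - 1)`; the vertices `q 0, …, q (h - 1)` have been processed. -/
structure Inv {n : ℕ} (G : Digraph (Fin n)) (a : Fin n) (lay q : ℕ → ℕ) (h t : ℕ) : Prop where
  lay_hole : lay n = 0
  lay_start : lay a = 0
  queue_lt : ∀ i < t, q i < n
  queue_inj : ∀ i < t, ∀ j < t, q i = q j → i = j
  lay_le : ∀ i < t, lay (q i) ≤ i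
  discovered : ∀ v < n, lay v ≠ n → ∃ i < t, q i = v
  head_le : h ≤ t
  mono : ∀ i j, i ≤ j → j < t → lay (q i) ≤ lay (q j)
  window : h < t → ∀ j < t, lay (q j) ≤ lay (q h) + 1
  processed : ∀ i < h, ∀ v w : Fin n, q i = v → G.Adj v w → lay w ≠ n ∧ lay w ≤ lay v + 1
  parent : ∀ w : Fin n, w ≠ a → lay w ≠ n → ∃ x : Fin n, G.Adj x w ∧ lay x ≠ n ∧ lay w = lay x + 1

namespace Inv

variable {n : ℕ} {G : Digraph (Fin n)} {a : Fin n} {lay q : ℕ → ℕ} {h t : ℕ}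

theorem tail_le (I : Inv G a lay q h t) : t ≤ n := by
  have := Finset.card_le_card_of_injOn (s := Finset.range t) (t := Finset.range n) q
    (fun i hi => by simpa using I.queue_lt i (by simpa using hi))
    (fun i hi j hj => I.queue_inj i (by simpa using hi) j (by simpa using hj))
  simpa using this

theorem lay_queue_lt (I : Inv G a lay q h t) {i : ℕ} (hi : i < t) : lay (q i) < n :=
  ((I.lay_le i hi).trans_lt hi).trans_le I.tail_le

theorem tail_lt (I : Inv G a lay q h t) {w : ℕ} (hw : w < n) (hl : lay w = n) : t < n := by
  have := Finset.card_le_card_of_injOn (s := Finset.range t) (t := (Finset.range n).erase w) q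
    (fun i hi => by
      have hi : i < t := by simpa using hi
      have : q i ≠ w := fun e => (I.lay_queue_lt hi).ne (by rw [e, hl])
      simpa using And.intro (I.queue_lt i hi) this)
    (fun i hi j hj => I.queue_inj i (by simpa using hi) j (by simpa using hj))
  rw [Finset.card_erase_of_mem (by simpa using hw), Finset.card_range, Finset.card_range] at this
  omega

/-- The undiscovered neighbours of a vertex. -/
def undiscovered (G : Digraph (Fin n)) (lay : ℕ → ℕ) (v : Fin n) : Set (Fin n) :=
  {w | G.Adj v w ∧ lay w = n}

theorem tail_add_ncard_le (I : Inv G a lay q h t) (v : Fin n) :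
    t + (undiscovered G lay v).ncard ≤ n := by
  classical
  set U := (Set.toFinite (undiscovered G lay v)).toFinset with hU
  have hsub : (Finset.range t).image q ∪ U.image Fin.val ⊆ Finset.range n := by
    intro x hx
    rcases Finset.mem_union.1 hx with hx | hx
    · obtain ⟨i, hi, rfl⟩ := Finset.mem_image.1 hx
      simpa using I.queue_lt i (by simpa using hi)
    · obtain ⟨w, -, rfl⟩ := Finset.mem_image.1 hx
      simp
  have hdis : Disjoint ((Finset.range t).image q) (U.image Fin.val) := by
    rw [Finset.disjoint_left]
    intro x hx hx'
    obtain ⟨i, hi, rfl⟩ := Finset.mem_image.1 hx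
    obtain ⟨w, hw, e⟩ := Finset.mem_image.1 hx'
    have h1 := (I.lay_queue_lt (i := i) (by simpa using hi)).ne
    rw [← e] at h1
    exact h1 ((Set.Finite.mem_toFinset _).1 hw).2
  have := Finset.card_le_card hsub
  rwa [Finset.card_union_of_disjoint hdis, Finset.card_image_of_injOn fun i hi j hj =>
    I.queue_inj i (by simpa using hi) j (by simpa using hj),
    Finset.card_image_of_injective _ Fin.val_injective, hU, ← Set.ncard_eq_toFinset_card,
    Finset.card_range, Finset.card_range] at this

theorem init (h1 : ∀ v < n, v ≠ a → lay v = n) (h2 : lay a = 0) (h3 : lay n = 0)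
    (h4 : q 0 = a) : Inv G a lay q 0 1 where
  lay_hole := h3
  lay_start := h2
  queue_lt i hi := by rw [Nat.lt_one_iff.1 hi, h4]; exact a.2
  queue_inj i hi j hj _ := by omega
  lay_le i hi := by rw [Nat.lt_one_iff.1 hi, h4, h2]
  discovered v hv hl := ⟨0, one_pos, by
    by_contra hne
    exact hl (h1 v hv fun e => hne (by rw [h4, e]))⟩
  head_le := zero_le_one
  mono i j hij hj := by
    obtain rfl : i = j := by omega
    rfl
  window _ j hj := by rw [Nat.lt_one_iff.1 hj]; omega
  processed i hi := absurd hi (by omega)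
  parent w hw hl := absurd (h1 w w.2 fun e => hw (Fin.ext e)) hl

theorem discover (I : Inv G a lay q h t) (ht : h < t) {v w : Fin n} (hv : q h = v)
    (hvw : G.Adj v w) (hw : lay w = n) :
    Inv G a (Function.update lay w (lay v + 1)) (Function.update q t w) h (t + 1) := by
  have tn := I.tail_lt w.2 hw
  have hvl : lay v ≤ h := hv ▸ I.lay_le h ht
  have hne : ∀ x : ℕ, lay x ≠ n → x ≠ w := fun x hx e => hx (by rw [e, hw])
  have old : ∀ x : ℕ, lay x ≠ n → Function.update lay w (lay v + 1) x = lay x := fun x hx =>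
    Function.update_of_ne (hne x hx) _ _
  have oldq : ∀ i, i < t → Function.update q t w i = q i := fun i hi =>
    Function.update_of_ne (by omega) _ _
  have newq : Function.update q t w t = w := Function.update_self _ _ _
  have new : Function.update lay w (lay v + 1) w = lay v + 1 := Function.update_self _ _ _
  have layq : ∀ i, i < t → Function.update lay w (lay v + 1) (Function.update q t w i) =
      lay (q i) := fun i hi => by rw [oldq i hi, old _ (I.lay_queue_lt hi).ne]
  have layt : Function.update lay w (lay v + 1) (Function.update q t w t) = lay v + 1 := by
    rw [newq, new]
  have disc : ∀ x : ℕ, Function.update lay w (lay v + 1) x ≠ n → x ≠ w → lay x ≠ n := by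
    intro x hx hxw
    rwa [Function.update_of_ne hxw] at hx
  have cases_lt : ∀ i, i < t + 1 → i < t ∨ i = t := fun i hi => by omega
  have hvn : lay v ≠ n := hv ▸ (I.lay_queue_lt ht).ne
  constructor
  · rw [old _ (by rw [I.lay_hole]; omega), I.lay_hole]
  · rw [old _ (by rw [I.lay_start]; omega), I.lay_start]
  · intro i hi
    rcases cases_lt i hi with hi | rfl
    · rw [oldq i hi]; exact I.queue_lt i hi
    · rw [newq]; exact w.2
  · intro i hi j hj e
    rcases cases_lt i hi with hi | rfl <;> rcases cases_lt j hj with hj | rfl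
    · rw [oldq i hi, oldq j hj] at e; exact I.queue_inj i hi j hj e
    · rw [oldq i hi, newq] at e; exact absurd e (hne _ (I.lay_queue_lt hi).ne)
    · rw [oldq j hj, newq] at e; exact absurd e.symm (hne _ (I.lay_queue_lt hj).ne)
    · rfl
  · intro i hi
    rcases cases_lt i hi with hi | rfl
    · rw [layq i hi]; exact I.lay_le i hi
    · rw [layt]; omega
  · intro x hx hl
    by_cases hxw : x = w
    · exact ⟨t, by omega, by rw [newq, hxw]⟩
    · obtain ⟨i, hi, e⟩ := I.discovered x hx (disc x hl hxw)
      exact ⟨i, by omega, by rw [oldq i hi, e]⟩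
  · omega
  · intro i j hij hj
    rcases cases_lt j hj with hj | rfl
    · rw [layq i (by omega), layq j hj]; exact I.mono i j hij hj
    · rw [layt]
      rcases cases_lt i (by omega) with hi | rfl
      · rw [layq i hi, ← hv]; exact I.window ht i hi
      · rw [layt]
  · intro _ j hj
    rw [layq h ht]
    rcases cases_lt j hj with hj | rfl
    · rw [layq j hj]; exact I.window ht j hj
    · rw [layt, hv]
  · intro i hi x y hx hxy
    rw [oldq i (by omega)] at hx
    obtain ⟨h1, h2⟩ := I.processed i hi x y hx hxy
    have := (I.lay_queue_lt (hi.trans ht)).ne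
    rw [old _ h1, old _ (hx ▸ this)]
    exact ⟨h1, h2⟩
  · intro y hya hy
    by_cases hyw : y = w
    · subst hyw
      exact ⟨v, hvw, by rw [old _ hvn]; exact hvn, by rw [new, old _ hvn]⟩
    · have hyw' : (y : ℕ) ≠ w := fun e => hyw (Fin.ext e)
      have := disc y hy hyw'
      obtain ⟨x, h1, h2, h3⟩ := I.parent y hya this
      exact ⟨x, h1, by rw [old _ h2]; exact h2, by rw [old _ h2, old _ this]; exact h3⟩

theorem advance (I : Inv G a lay q h t) (ht : h < t) {v : Fin n} (hv : q h = v)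
    (hno : undiscovered G lay v = ∅) : Inv G a lay q (h + 1) t :=
  { I with
    head_le := ht
    window := fun h1 j hj => (I.window ht j hj).trans
      (Nat.add_le_add_right (I.mono h (h + 1) (by omega) h1) 1)
    processed := fun i hi x y hx hxy => by
      rcases Nat.lt_succ_iff_lt_or_eq.1 hi with hi | rfl
      · exact I.processed i hi x y hx hxy
      · obtain rfl : v = x := Fin.ext (hv.symm.trans hx)
        have hy : lay y ≠ n := fun e => by
          have : y ∈ undiscovered G lay v := ⟨hxy, e⟩
          simp [hno] at this
        obtain ⟨j, hj, e⟩ := I.discovered y y.2 hy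
        exact ⟨hy, by rw [← e, ← hv]; exact I.window ht j hj⟩ }

theorem isLayering (I : Inv G a lay q t t) {μ : Mem} (hμ : μ.arrs .lay = lay) :
    IsLayering G a (storedLayers n μ) := by
  have hn : 0 < n := a.pos
  have fin : ∀ v : Fin n, lay v ≠ n → storedLayers n μ v = (lay v : ℕ∞) := fun v hv => by
    simp [storedLayers, hμ, hv]
  have inf : ∀ v : Fin n, lay v = n → storedLayers n μ v = ⊤ := fun v hv => by
    simp [storedLayers, hμ, hv]
  have succ : ∀ x y : Fin n, G.Adj x y → lay x ≠ n → lay y ≠ n ∧ lay y ≤ lay x + 1 := by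
    intro x y hxy hx
    obtain ⟨i, hi, e⟩ := I.discovered x x.2 hx
    exact I.processed i hi x y e hxy
  refine ⟨by rw [fin a (by rw [I.lay_start]; omega), I.lay_start]; rfl, fun y hya => ?_⟩
  by_cases hy : lay y = n
  · rw [inf y hy]
    symm
    rw [ENat.add_eq_top]
    right
    simp only [iInf_eq_top]
    intro x hxy
    exact inf x (by by_contra hx; exact (succ x y hxy hx).1 hy)
  · apply le_antisymm
    · rw [ENat.add_iInf]
      refine le_iInf fun x => ?_
      rw [ENat.add_iInf]
      refine le_iInf fun hxy => ?_
      by_cases hx : lay x = n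
      · rw [inf x hx]; simp
      · rw [fin y hy, fin x hx, add_comm]
        exact_mod_cast (succ x y hxy hx).2
    · obtain ⟨x, h1, h2, h3⟩ := I.parent y hya hy
      rw [fin y hy, h3, Nat.cast_add, Nat.cast_one, add_comm, ← fin x h2]
      gcongr
      exact iInf₂_le x h1

end Inv

/-! ### Graphs in a black box -/

/-- The number of entries of the row, respectively the list, of `v`. -/
def rowLen (M : Model) (B : BlackBox) (n v : ℕ) : ℕ :=
  match M with
  | .adjacency => n
  | .list => B.len v

/-- The entries of the rows, respectively lists, of the black box lead exactly to the heads of the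
edges of `G`. -/
structure Presents {n : ℕ} (M : Model) (B : BlackBox) (G : Digraph (Fin n)) : Prop where
  sound : ∀ (v : Fin n) (i : ℕ), target M B n v i = n ∨
    ∃ w : Fin n, target M B n v i = w ∧ G.Adj v w
  complete : ∀ v w : Fin n, G.Adj v w → ∃ i < rowLen M B n v, target M B n v i = w

theorem presents_adjacencyBox {n : ℕ} (G : Digraph (Fin n)) :
    Presents .adjacency (adjacencyBox G) G where
  sound v i := by
    by_cases h : ∃ (hv : (v : ℕ) < n) (hw : i < n), G.Adj ⟨v, hv⟩ ⟨i, hw⟩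
    · have e : (adjacencyBox G).entry v i = 1 := if_pos h
      obtain ⟨_, hw, hvw⟩ := h
      exact Or.inr ⟨⟨i, hw⟩, if_pos e, hvw⟩
    · have e : (adjacencyBox G).entry v i = 0 := if_neg h
      exact Or.inl (if_neg (by rw [e]; exact zero_ne_one))
  complete v w h := ⟨w, w.2, by simp [target, adjacencyBox, h]⟩

theorem presents_box {n : ℕ} {G : Digraph (Fin n)} {N : Lists n} (h : N.Represents G) :
    Presents .list N.box G where
  sound v i := by
    simp only [target, Lists.box]
    rw [dif_pos v.2]
    split_ifs with hj
    · cases e : N.entry v ⟨i, hj⟩ with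
      | none => exact Or.inl rfl
      | some w => exact Or.inr ⟨w, rfl, (h v w).2 ⟨_, e⟩⟩
    · exact Or.inl rfl
  complete v w hvw := by
    obtain ⟨j, hj⟩ := (h v w).1 hvw
    exact ⟨j, by simp [rowLen, Lists.box], by simp [target, Lists.box, hj]⟩

section Marked

variable {n : ℕ} {G : Digraph (Fin n)} {M : Model} {B : BlackBox} {μ : Mem} {v : Fin n}

theorem exists_of_marked (hP : Presents M B G) (hsize : μ.vars .size = n)
    (hcur : μ.vars .cur = v) (h0 : μ.arrs .lay n = 0) {i : ℕ} (hi : Marked M B μ i) :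
    ∃ w ∈ Inv.undiscovered G (μ.arrs .lay) v, target M B n v i = w := by
  rw [Marked, hsize, hcur] at hi
  rcases hP.sound v i with h | ⟨w, h1, h2⟩
  · rw [h, h0] at hi
    exact absurd v.pos (by omega)
  · exact ⟨w, ⟨h2, by rw [← h1]; exact hi⟩, h1⟩

open Classical in
/-- Different undiscovered neighbours are found at different indices. -/
theorem ncard_undiscovered_le (hP : Presents M B G) (hsize : μ.vars .size = n)
    (hcur : μ.vars .cur = v) {N : ℕ} (hN : rowLen M B n v ≤ N) :
    (Inv.undiscovered G (μ.arrs .lay) v).ncard ≤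
      ((Finset.range N).filter (Marked M B μ)).card := by
  rw [← Set.ncard_coe_finset]
  have ex : ∀ w ∈ Inv.undiscovered G (μ.arrs .lay) v, ∃ i < rowLen M B n v,
      target M B n v i = w := fun w hw => hP.complete v w hw.1
  choose! f hf1 hf2 using ex
  refine Set.ncard_le_ncard_of_injOn f (fun w hw => ?_) (fun w hw x hx e => ?_)
    (Finset.finite_toSet _)
  · have h1 := hf1 w hw
    have h2 := hf2 w hw
    simp only [Finset.coe_filter, Finset.mem_range, Set.mem_ofPred_eq]
    exact ⟨by omega, by rw [Marked, hsize, hcur, h2]; exact hw.2⟩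
  · have h1 := hf2 w hw
    rw [e, hf2 x hx] at h1
    exact Fin.ext h1.symm

end Marked

/-! ### The running time of quantum breadth-first search -/

/-- The probability that a search with at least one solution succeeds is at least this number, if each
stage has `R` runs. -/
noncomputable def searchBound (R : ℕ) : ℝ := 1 - (3 / 4) ^ R

theorem searchBound_nonneg (R : ℕ) : 0 ≤ searchBound R :=
  sub_nonneg.2 (pow_le_one₀ (by norm_num) (by norm_num))

theorem searchBound_le_one (R : ℕ) : searchBound R ≤ 1 :=
  sub_le_self _ (by positivity)

/-- The memory `μ` holds the state of breadth-first search with `h` processed and `t` discovered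
vertices. -/
structure Holds {n : ℕ} (G : Digraph (Fin n)) (a : Fin n) (R : ℕ) (μ : Mem) (h t : ℕ) : Prop where
  inv : Inv G a (μ.arrs .lay) (μ.arrs .queue) h t
  size : μ.vars .size = n
  reps : μ.vars .reps = R
  head : μ.vars .head = h
  tail : μ.vars .tail = t

section Queue

variable {n : ℕ} {G : Digraph (Fin n)} {a : Fin n} {R : ℕ} {M : Model} {B : BlackBox}
  {good : Mem → Prop} {μ μ' : Mem} {h t k u : ℕ} {v : Fin n}

theorem Holds.congr {K : List Var} (H : Holds G a R μ h t) (hag : Agree K μ μ')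
    (hK : [.size, .reps, .head, .tail] ⊆ K) : Holds G a R μ' h t where
  inv := by rw [hag.1]; exact H.inv
  size := (hag.2 _ (hK (by simp))).trans H.size
  reps := (hag.2 _ (hK (by simp))).trans H.reps
  head := (hag.2 _ (hK (by simp))).trans H.head
  tail := (hag.2 _ (hK (by simp))).trans H.tail

/-- After a successful search, the neighbour that was found gets its layer number and is appended to
the queue. -/
def record : Cmd :=
  .cond (.eq (.var .found) (.lit 1))
    [ .put .lay (.var .y) (.plus (.get .lay (.var .cur)) (.lit 1)),
      .put .queue (.var .tail) (.var .y),
      incr .tail]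

/-- The loop that finds the undiscovered neighbours of `cur` one after the other. -/
def findLoop (M : Model) : Cmd :=
  .loop (.eq (.var .found) (.lit 1)) (search M ++ [record])

open Classical in
/-- If `u` neighbours are undiscovered, then the times `√(2 ^ k / u), …, √(2 ^ k / 1)` of the
successful searches sum up to at most `2 √(2 ^ k * u)`. -/
theorem ens_findLoop (hP : Presents M B G) (hR : 1 ≤ R) (H : Holds G a R μ h t) (ht : h < t)
    (hv : μ.arrs .queue h = v) (hcur : μ.vars .cur = v) (hk : μ.vars .bits = k)
    (hlen : rowLen M B n v ≤ 2 ^ k) (hf : μ.vars .found = 1)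
    (hu : (Inv.undiscovered G (μ.arrs .lay) v).ncard = u) :
    Ens B good (searchBound R ^ u) (85 * R * √(2 ^ k) * (2 * √u + 1) + 1) [findLoop M] μ
      fun μ' => Holds G a R μ' h (t + u) ∧ (∀ i < t, μ'.arrs .queue i = μ.arrs .queue i) ∧
        Inv.undiscovered G (μ'.arrs .lay) v = ∅ := by
  have hR' : (1 : ℝ) ≤ R := by exact_mod_cast hR
  have hN : (1 : ℝ) ≤ √(2 ^ k) := Real.one_le_sqrt.2 (one_le_pow₀ (by norm_num))
  have hRN : (1 : ℝ) ≤ R * √(2 ^ k) := by nlinarith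
  induction u generalizing μ t with
  | zero =>
    have hlay := H.inv.lay_hole
    have hun : Inv.undiscovered G (μ.arrs .lay) v = ∅ :=
      (Set.ncard_eq_zero (Set.toFinite _)).1 hu
    have hno : ∀ i, ¬Marked M B μ i := fun i hi => by
      obtain ⟨w, hw, -⟩ := exists_of_marked hP H.size hcur hlay hi
      simp [hun] at hw
    have body : Ens B good 1 (80 * R * √(2 ^ k) + (0 + 1 + 1))
        (search M ++ ([record] ++ [findLoop M])) μ fun μ' => Holds G a R μ' h (t + 0) ∧
          (∀ i < t, μ'.arrs .queue i = μ.arrs .queue i) ∧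
          Inv.undiscovered G (μ'.arrs .lay) v = ∅ := by
      refine Ens.seq_one (ens_search_none (R := R) (by
        rw [H.size, hlay]; exact v.pos.ne) hk H.reps hR hno) (fun μ' h' => ?_)
        (by norm_num) zero_le_one
      refine Ens.cond_neg (by simp [Test.holds, Arith.eval, h'.2]) (Ens.loop_neg
        (by simp [Test.holds, Arith.eval, h'.2]) (Ens.nil ⟨H.congr h'.1 (by decide), ?_, ?_⟩))
      · intro i _; rw [h'.1.1]
      · rw [h'.1.1]; exact hun
    rw [← List.append_assoc] at body
    refine (Ens.loop_pos (by simp [Test.holds, Arith.eval, hf]) body).mono (by simp) ?_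
      fun _ h' => h'
    rw [Nat.cast_zero, Real.sqrt_zero]
    linarith
  | succ u ih =>
    have hlay := H.inv.lay_hole
    have hcard := ncard_undiscovered_le (M := M) (B := B) (G := G) hP H.size hcur hlen
    rw [hu] at hcard
    have hδ := searchBound_nonneg R
    have hu0 : (0 : ℝ) < √((u + 1 : ℕ) : ℝ) := Real.sqrt_pos.2 (by positivity)
    have hu1 : (1 : ℝ) ≤ √(2 ^ k) / √((u + 1 : ℕ) : ℝ) := by
      rw [one_le_div hu0]
      refine Real.sqrt_le_sqrt ?_
      have : u + 1 ≤ 2 ^ k := hcard.trans ((Finset.card_filter_le _ _).trans (by simp))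
      exact_mod_cast this
    -- the telescoping bound for the sum of `1 / √u`
    have htel : 1 / √((u + 1 : ℕ) : ℝ) + 2 * √(u : ℝ) ≤ 2 * √((u + 1 : ℕ) : ℝ) := by
      have e1 : √((u + 1 : ℕ) : ℝ) ^ 2 = u + 1 := by rw [Real.sq_sqrt (by positivity)]; simp
      have e2 : √(u : ℝ) ^ 2 = u := Real.sq_sqrt (by positivity)
      rw [← sub_nonneg]
      have : 2 * √((u + 1 : ℕ) : ℝ) - (1 / √((u + 1 : ℕ) : ℝ) + 2 * √(u : ℝ)) =
          (√((u + 1 : ℕ) : ℝ) - √(u : ℝ)) ^ 2 / √((u + 1 : ℕ) : ℝ) := by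
        field_simp
        linear_combination e1 - e2
      rw [this]
      positivity
    have body : Ens B good (searchBound R * searchBound R ^ u)
        (80 * R * (√(2 ^ k) / √((u + 1 : ℕ) : ℝ)) +
          (85 * R * √(2 ^ k) * (2 * √u + 1) + 1 + 1 + 1 + 1 + 1))
        (search M ++ ([record] ++ [findLoop M])) μ fun μ' => Holds G a R μ' h (t + (u + 1)) ∧
          (∀ i < t, μ'.arrs .queue i = μ.arrs .queue i) ∧
          Inv.undiscovered G (μ'.arrs .lay) v = ∅ := by
      refine Ens.seq (ens_search_found (R := R) (t := u + 1) (by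
        rw [H.size, hlay]; exact v.pos.ne) hk H.reps hR (by omega) hcard)
        (pow_nonneg hδ _) (fun μ' h' => ?_) (by positivity)
      obtain ⟨hag, hf', i, hi, hy⟩ := h'
      rw [H.size, hcur] at hy
      obtain ⟨w, hw, hwi⟩ := exists_of_marked hP H.size hcur hlay hi
      rw [hwi] at hy
      have H' := H.congr hag (by decide)
      have hcur' : μ'.vars .cur = v := (hag.2 _ (by decide)).trans hcur
      refine Ens.cond_pos (by simp [Test.holds, Arith.eval, hf']) (Ens.put (Ens.put (Ens.set ?_)))
      simp only [Arith.eval, Mem.setArr, hy, hcur', H'.tail, hag.1]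
      set ν : Mem := Mem.setVar _ _ _ with hν
      have hνl : ν.arrs .lay = Function.update (μ.arrs .lay) w (μ.arrs .lay v + 1) := by
        simp [hν, Mem.setVar]
      have hνq : ν.arrs .queue = Function.update (μ.arrs .queue) t w := by
        simp [hν, Mem.setVar]
      have hνH : Holds G a R ν h (t + 1) := by
        refine ⟨?_, H'.size, H'.reps, H'.head, Mem.setVar_self _ _⟩
        rw [hνl, hνq]
        exact H.inv.discover ht hv hw.1 hw.2
      have hνu : (Inv.undiscovered G (ν.arrs .lay) v).ncard = u := by
        have : Inv.undiscovered G (ν.arrs .lay) v =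
            Inv.undiscovered G (μ.arrs .lay) v \ {w} := by
          ext x
          rw [hνl]
          by_cases hx : x = w
          · subst hx
            have hle : μ.arrs .lay v + 1 ≠ n := by
              have h1 := H.inv.lay_le h ht
              have h2 := H.inv.tail_lt x.2 hw.2
              rw [hv] at h1
              omega
            simp [Inv.undiscovered, hle]
          · have hx' : (x : ℕ) ≠ w := fun e => hx (Fin.ext e)
            simp [Inv.undiscovered, hx, hx']
        rw [this, Set.ncard_sdiff_singleton_of_mem hw, hu, Nat.add_sub_cancel]
      refine (ih (μ := ν) (t := t + 1) hνH (by omega) ?_ hcur'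
        ((hag.2 _ (by decide)).trans hk) hf' hνu).mono le_rfl le_rfl ?_
      · rw [hνq, Function.update_of_ne (by omega), hv]
      · rintro μ'' ⟨h1, h2, h3⟩
        refine ⟨by rw [show t + (u + 1) = t + 1 + u by ring]; exact h1, fun i hi => ?_, h3⟩
        rw [h2 i (by omega), hνq, Function.update_of_ne (by omega)]
    rw [← List.append_assoc] at body
    refine (Ens.loop_pos (by simp [Test.holds, Arith.eval, hf]) body).mono
      (by rw [pow_succ, mul_comm]) ?_ fun _ h' => h'
    · have e : 85 * (R : ℝ) * √(2 ^ k) * (1 / √((u + 1 : ℕ) : ℝ) + 2 * √(u : ℝ)) ≤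
          85 * R * √(2 ^ k) * (2 * √((u + 1 : ℕ) : ℝ)) :=
        mul_le_mul_of_nonneg_left htel (by positivity)
      have e2 : 85 * (R : ℝ) * √(2 ^ k) * (1 / √((u + 1 : ℕ) : ℝ) + 2 * √(u : ℝ)) =
        85 * (R * (√(2 ^ k) / √((u + 1 : ℕ) : ℝ))) + 85 * R * √(2 ^ k) * (2 * √(u : ℝ)) := by ring
      have e3 : 1 ≤ (R : ℝ) * (√(2 ^ k) / √((u + 1 : ℕ) : ℝ)) := by nlinarith
      linarith

/-- The loop that computes `bits`. -/
def bitsLoop : Cmd :=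
  .loop (.lt (.var .dim) (.var .deg)) [.set .dim (.plus (.var .dim) (.var .dim)), incr .bits]

theorem ens_bitsLoop {d : ℕ} (hd : μ.vars .deg = d) (j : ℕ) (hj : j ≤ Nat.clog 2 d)
    (hbits : μ.vars .bits = Nat.clog 2 d - j) (hdim : μ.vars .dim = 2 ^ (Nat.clog 2 d - j)) :
    Ens B good 1 (3 * j + 1) [bitsLoop] μ
      fun μ' => Agree [.size, .head, .tail, .cur, .reps] μ μ' ∧ μ'.vars .bits = Nat.clog 2 d := by
  induction j generalizing μ with
  | zero =>
    refine (Ens.loop_neg ?_ (Ens.nil ⟨Agree.refl, by simpa using hbits⟩)).mono le_rfl (by simp)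
      fun _ h' => h'
    simpa [Test.holds, Arith.eval, hdim, hd] using Nat.le_pow_clog (by norm_num) d
  | succ j ih =>
    set μ₁ := μ.setVar .dim (2 ^ (Nat.clog 2 d - j)) with hμ₁
    set μ₂ := μ₁.setVar .bits (Nat.clog 2 d - j) with hμ₂
    have hs : Nat.clog 2 d - j = Nat.clog 2 d - (j + 1) + 1 := by omega
    have hag : Agree [.size, .head, .tail, .cur, .reps] μ μ₂ :=
      (Agree.refl.setVar (by decide) _).setVar (by decide) _
    have := (ih (μ := μ₂) (by simpa [hμ₂, hμ₁, Mem.setVar] using hd) (by omega)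
      (by simp [hμ₂, Mem.setVar]) (by simp [hμ₂, hμ₁, Mem.setVar]))
    refine (Ens.loop_pos ?_ (Ens.set (Ens.set (t := 3 * j + 1) (c := [bitsLoop]) ?_))).mono
      le_rfl ?_ fun _ h' => h'
    · simp only [Test.holds, Arith.eval, hdim, hd]
      exact (Nat.lt_clog_iff_pow_lt (by norm_num)).1 (by omega)
    · have e : (μ.setVar .dim (Arith.eval μ (.plus (.var .dim) (.var .dim)))) = μ₁ := by
        simp only [Arith.eval, hdim, hμ₁, hs, pow_succ, mul_two]
      have e' : μ₁.setVar .bits (Arith.eval μ₁ (.plus (.var .bits) (.lit 1))) = μ₂ := by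
        simp only [Arith.eval, hμ₂]
        congr 1
        simp [hμ₁, Mem.setVar, hbits, hs]
      rw [e, e']
      exact this.mono le_rfl le_rfl fun _ h' => ⟨hag.trans h'.1, h'.2⟩
    · push_cast
      linarith

theorem add_one_le_two_sqrt (k : ℕ) : (k : ℝ) + 1 ≤ 2 * √(2 ^ k) := by
  have h : ∀ k : ℕ, (k + 1) ^ 2 ≤ 4 * 2 ^ k := by
    intro k
    induction k with
    | zero => norm_num
    | succ k ih =>
      rcases Nat.lt_or_ge k 2 with hk | hk
      · interval_cases k <;> norm_num
      · rw [pow_succ 2]; nlinarith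
  refine le_of_sq_le_sq ?_ (by positivity)
  rw [mul_pow, Real.sq_sqrt (by positivity)]
  have := h k
  norm_num
  exact_mod_cast this

/-- The number of indices in a search from `v`. -/
def searchSize (M : Model) (B : BlackBox) (n v : ℕ) : ℕ := 2 ^ Nat.clog 2 (rowLen M B n v)

theorem process_eq (M : Model) : process M =
    [degree M, .set .bits (.lit 0), .set .dim (.lit 1), bitsLoop, .set .found (.lit 1),
      findLoop M] := rfl

theorem Ens.degree {δ s : ℝ} {c : List Cmd} {Q : Mem → Prop} (hsize : μ.vars .size = n)
    (hcur : μ.vars .cur = v) (h : Ens B good δ s c (μ.setVar .deg (rowLen M B n v)) Q) :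
    Ens B good δ (s + 1) (degree M :: c) μ Q := by
  cases M
  · exact Ens.set (by simpa only [Arith.eval, hsize, rowLen] using h)
  · exact Ens.len (by simpa only [Arith.eval, hcur, rowLen] using h)

theorem ens_process (hP : Presents M B G) (hR : 1 ≤ R) (H : Holds G a R μ h t) (ht : h < t)
    (hv : μ.arrs .queue h = v) (hcur : μ.vars .cur = v)
    (hu : (Inv.undiscovered G (μ.arrs .lay) v).ncard = u) :
    Ens B good (searchBound R ^ u) (297 * R * √(searchSize M B n v * (u + 1))) (process M) μ
      fun μ' => Holds G a R μ' h (t + u) ∧ (∀ i < t, μ'.arrs .queue i = μ.arrs .queue i) ∧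
        Inv.undiscovered G (μ'.arrs .lay) v = ∅ := by
  set d := rowLen M B n v with hd
  set k := Nat.clog 2 d with hk
  have hkN : ((searchSize M B n v : ℕ) : ℝ) = 2 ^ k := by rw [searchSize, ← hd, ← hk]; simp
  have hR' : (1 : ℝ) ≤ R := by exact_mod_cast hR
  have hN : (1 : ℝ) ≤ √(2 ^ k) := Real.one_le_sqrt.2 (one_le_pow₀ (by norm_num))
  have hRN : √(2 ^ k) ≤ R * √(2 ^ k) := by nlinarith
  set ν := ((μ.setVar .deg d).setVar .bits 0).setVar .dim 1 with hν
  have hag : Agree [.size, .head, .tail, .cur, .reps] μ ν :=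
    ((Agree.refl.setVar (by decide) _).setVar (by decide) _).setVar (by decide) _
  rw [process_eq]
  refine (Ens.degree H.size hcur (Ens.set (Ens.set (Ens.seq_one
    (c := [bitsLoop]) (c' := [.set .found (.lit 1), findLoop M]) (t := 3 * k + 1)
    (t' := 85 * R * √(2 ^ k) * (2 * √u + 1) + 1 + 1) (δ := searchBound R ^ u)
    (ens_bitsLoop (μ := ν) (d := d) (by simp [hν, Mem.setVar]) k le_rfl
      (by simp [hν, Mem.setVar, hk]) (by simp [hν, Mem.setVar, hk])) (fun μ' h' => ?_)
    (by positivity) (pow_nonneg (searchBound_nonneg R) _))))).mono le_rfl ?_ fun _ h' => h'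
  · obtain ⟨hag', hbits⟩ := h'
    have hag'' := hag.trans hag'
    set μ₁ := μ'.setVar .found 1 with hμ₁
    have hag₁ : Agree [.size, .head, .tail, .cur, .reps] μ μ₁ := hag''.setVar (by decide) _
    have h1 : μ₁.arrs .queue h = v := by rw [hag₁.1]; exact hv
    have h2 : (Inv.undiscovered G (μ₁.arrs .lay) v).ncard = u := by rw [hag₁.1]; exact hu
    refine Ens.set ((ens_findLoop (k := k) hP hR (H.congr hag₁ (by decide)) ht h1
      ((hag₁.2 _ (by decide)).trans hcur) (by simpa [hμ₁, Mem.setVar] using hbits)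
      (Nat.le_pow_clog (by norm_num) _) (by simp [hμ₁]) h2).mono le_rfl le_rfl ?_)
    rintro μ'' ⟨e1, e2, e3⟩
    exact ⟨e1, fun i hi => by rw [e2 i hi, hag₁.1], e3⟩
  · have hk1 := add_one_le_two_sqrt k
    have hs : √(2 ^ k) * √((u : ℝ) + 1) = √(searchSize M B n v * (u + 1)) := by
      rw [hkN, Real.sqrt_mul (by positivity)]
    have hu3 : 2 * √(u : ℝ) + 1 ≤ 3 * √((u : ℝ) + 1) := by
      have h1 : √(u : ℝ) ≤ √((u : ℝ) + 1) := Real.sqrt_le_sqrt (by linarith)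
      have h2 : 1 ≤ √((u : ℝ) + 1) := Real.one_le_sqrt.2 (by
        have : (0 : ℝ) ≤ u := by positivity
        linarith)
      linarith
    have hu1 : (1 : ℝ) ≤ 2 * √(u : ℝ) + 1 := by
      have : 0 ≤ √(u : ℝ) := by positivity
      linarith
    have e0 : (R : ℝ) * √(2 ^ k) ≤ R * √(2 ^ k) * (2 * √u + 1) :=
      le_mul_of_one_le_right (by positivity) hu1
    have e1 : (R : ℝ) * √(2 ^ k) * (2 * √u + 1) ≤ R * √(2 ^ k) * (3 * √((u : ℝ) + 1)) :=
      mul_le_mul_of_nonneg_left hu3 (by positivity)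
    rw [← hs]
    linarith

/-- The loop over the queue. -/
def queueLoop (M : Model) : Cmd :=
  .loop (.lt (.var .head) (.var .tail)) (
    [.set .cur (.get .queue (.var .head))] ++ process M ++ [incr .head])

/-- The Cauchy-Schwarz inequality for two summands. -/
theorem sqrt_mul_add_sqrt_mul_le {w x y z : ℝ} (hw : 0 ≤ w) (hx : 0 ≤ x) (hy : 0 ≤ y)
    (hz : 0 ≤ z) : √(w * x) + √(y * z) ≤ √((w + y) * (x + z)) := by
  rw [Real.sqrt_mul hw, Real.sqrt_mul hy]
  refine Real.le_sqrt_of_sq_le ?_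
  have h1 := Real.sq_sqrt hw
  have h2 := Real.sq_sqrt hx
  have h3 := Real.sq_sqrt hy
  have h4 := Real.sq_sqrt hz
  nlinarith [sq_nonneg (√w * √z - √x * √y)]

/-- Let `P` be the set of the processed vertices. By the Cauchy-Schwarz inequality, the remaining time
is bounded by the square root of the total search size of the unprocessed vertices times the number of
vertices that are still to be discovered or to be processed. -/
theorem ens_queueLoop (hP : Presents M B G) (hR : 1 ≤ R) (j : ℕ) (H : Holds G a R μ h t)
    (hj : n - h = j) (P : Finset (Fin n)) (hPP : ∀ x : Fin n, x ∈ P ↔ ∃ i < h, μ.arrs .queue i = x) :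
    Ens B good (searchBound R ^ (n - t))
      (300 * R * √((∑ x ∈ Pᶜ, (searchSize M B n x : ℝ)) * ((n - t) + (n - h))) + 1) [queueLoop M] μ
      fun μ' => IsLayering G a (storedLayers n μ') := by
  have hδ := searchBound_nonneg R
  have hR' : (1 : ℝ) ≤ R := by exact_mod_cast hR
  induction j generalizing μ h t P with
  | zero =>
    have h1 := H.inv.tail_le
    have h2 := H.inv.head_le
    obtain rfl : h = t := by omega
    refine (Ens.loop_neg ?_ (Ens.nil (H.inv.isLayering rfl))).mono
      (pow_le_one₀ hδ (searchBound_le_one R)) ?_ fun _ h' => h'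
    · simp [Test.holds, Arith.eval, H.head, H.tail]
    · have : 0 ≤ 300 * (R : ℝ) * √((∑ x ∈ Pᶜ, (searchSize M B n x : ℝ)) * ((n - h) + (n - h))) := by
        positivity
      linarith
  | succ j ih =>
    rcases H.inv.head_le.eq_or_lt with rfl | ht
    · refine (Ens.loop_neg ?_ (Ens.nil (H.inv.isLayering rfl))).mono
        (pow_le_one₀ hδ (searchBound_le_one R)) ?_ fun _ h' => h'
      · simp [Test.holds, Arith.eval, H.head, H.tail]
      · have : 0 ≤ 300 * (R : ℝ) *
            √((∑ x ∈ Pᶜ, (searchSize M B n x : ℝ)) * ((n - h) + (n - h))) := by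
          positivity
        linarith
    set v : Fin n := ⟨μ.arrs .queue h, H.inv.queue_lt h ht⟩ with hv
    set u := (Inv.undiscovered G (μ.arrs .lay) v).ncard with hu
    have hvP : v ∉ P := fun hm => by
      obtain ⟨i, hi, e⟩ := (hPP v).1 hm
      have := H.inv.queue_inj i (hi.trans ht) h ht e
      omega
    set A := ∑ x ∈ (insert v P)ᶜ, (searchSize M B n x : ℝ) with hA
    have hsum : ∑ x ∈ Pᶜ, (searchSize M B n x : ℝ) = searchSize M B n v + A := by
      rw [hA, Finset.compl_insert, Finset.add_sum_erase _ (fun x : Fin n => (searchSize M B n x : ℝ))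
        (Finset.mem_compl.2 hvP)]
    have hA0 : 0 ≤ A := Finset.sum_nonneg fun _ _ => by positivity
    set μ₁ := μ.setVar .cur v with hμ₁
    have hag : Agree [.size, .reps, .head, .tail] μ μ₁ := Agree.refl.setVar (by decide) _
    have hproc := ens_process (good := good) (u := u) hP hR (H.congr hag (by simp)) ht (v := v) rfl
      (by simp [hμ₁]) rfl
    have hhn : h < n := ht.trans_le H.inv.tail_le
    have hun : t + u ≤ n := H.inv.tail_add_ncard_le v
    have hunr : (t : ℝ) + u ≤ n := by exact_mod_cast hun
    have hhnr : (h : ℝ) + 1 ≤ n := by exact_mod_cast hhn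
    have hb0 : (0 : ℝ) ≤ (n - (t + u : ℕ)) + (n - (h + 1 : ℕ)) := by push_cast; linarith
    refine (Ens.loop_pos (by simpa [Test.holds, Arith.eval, H.head, H.tail] using ht)
      (Ens.set (c := process M ++ ([incr .head] ++ [queueLoop M])) ?_)).mono (t :=
        297 * R * √(searchSize M B n v * (u + 1)) + (300 * R * √(A * ((n - (t + u : ℕ)) +
          (n - (h + 1 : ℕ)))) + 1 + 1) + 1 + 1) (δ := searchBound R ^ u *
            searchBound R ^ (n - (t + u))) ?_ ?_ fun _ h' => h'
    · have e : Arith.eval μ (.get .queue (.var .head)) = v := by simp [Arith.eval, H.head, hv]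
      rw [e]
      refine Ens.seq hproc (pow_nonneg hδ _) (fun μ' h' => Ens.set ?_) (by positivity)
      obtain ⟨h1, h2, h3⟩ := h'
      refine ih (μ := μ'.setVar .head (μ'.vars .head + 1)) (h := h + 1) (t := t + u) ⟨?_, h1.size, h1.reps, ?_, h1.tail⟩ (by omega)
        (insert v P) fun x => ?_
      · exact h1.inv.advance (by omega) (v := v) (by rw [h2 h ht]; rfl) h3
      · simp [h1.head]
      · simp only [Mem.setVar_arrs, Finset.mem_insert, hPP]
        constructor
        · rintro (rfl | ⟨i, hi, e⟩)
          · exact ⟨h, by omega, by rw [h2 h ht]; rfl⟩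
          · exact ⟨i, by omega, by rw [h2 i (by omega)]; exact e⟩
        · rintro ⟨i, hi, hx⟩
          rcases Nat.lt_succ_iff_lt_or_eq.1 hi with hi | rfl
          · exact Or.inr ⟨i, hi, by rw [← hx, h2 i (by omega)]; rfl⟩
          · exact Or.inl (Fin.ext (by rw [← hx, h2 _ ht]; rfl))
    · rw [← pow_add]
      exact le_of_eq (congrArg _ (by omega))
    · have hcs := sqrt_mul_add_sqrt_mul_le (w := searchSize M B n v) (x := u + 1) (y := A)
        (z := (n - (t + u : ℕ)) + (n - (h + 1 : ℕ))) (by positivity) (by positivity) hA0 hb0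
      rw [hsum, show ((n : ℝ) - t) + (n - h) = (u + 1) + ((n - (t + u : ℕ)) + (n - (h + 1 : ℕ))) by
        push_cast; ring]
      have h1 : (1 : ℝ) ≤ √(searchSize M B n v * (u + 1)) := by
        refine Real.one_le_sqrt.2 ?_
        have e1 : (1 : ℝ) ≤ searchSize M B n v := by
          exact_mod_cast Nat.one_le_two_pow
        have e2 : (0 : ℝ) ≤ u := by positivity
        nlinarith
      have h2 : (1 : ℝ) ≤ R * √(searchSize M B n v * (u + 1)) := by nlinarith
      have h3 := mul_le_mul_of_nonneg_left hcs (show (0 : ℝ) ≤ 300 * R by positivity)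
      linarith

end Queue

/-! ### The initialization -/

section Bfs

variable {n : ℕ} {G : Digraph (Fin n)} {a : Fin n} {M : Model} {B : BlackBox}
  {good : Mem → Prop} {μ : Mem}

/-- The loop that computes `reps`. -/
def repsLoop (c : ℕ) : Cmd :=
  .loop (.lt (.var .dim) (.var .size))
    [.set .dim (.plus (.var .dim) (.var .dim)), .set .reps (.plus (.var .reps) (.lit c))]

theorem ens_repsLoop {c : ℕ} (hn : μ.vars .size = n) (j : ℕ) (hj : j ≤ Nat.clog 2 n)
    (hreps : μ.vars .reps = c * (1 + (Nat.clog 2 n - j)))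
    (hdim : μ.vars .dim = 2 ^ (Nat.clog 2 n - j)) :
    Ens B good 1 (3 * j + 1) [repsLoop c] μ
      fun μ' => Agree [.size, .src] μ μ' ∧ μ'.vars .reps = c * (1 + Nat.clog 2 n) := by
  induction j generalizing μ with
  | zero =>
    refine (Ens.loop_neg ?_ (Ens.nil ⟨Agree.refl, by simpa using hreps⟩)).mono le_rfl (by simp)
      fun _ h' => h'
    simpa [Test.holds, Arith.eval, hdim, hn] using Nat.le_pow_clog (by norm_num) n
  | succ j ih =>
    set μ₁ := μ.setVar .dim (2 ^ (Nat.clog 2 n - j)) with hμ₁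
    set μ₂ := μ₁.setVar .reps (c * (1 + (Nat.clog 2 n - j))) with hμ₂
    have hs : Nat.clog 2 n - j = Nat.clog 2 n - (j + 1) + 1 := by omega
    have hag : Agree [.size, .src] μ μ₂ := (Agree.refl.setVar (by decide) _).setVar (by decide) _
    have := (ih (μ := μ₂) (by simpa [hμ₂, hμ₁, Mem.setVar] using hn) (by omega)
      (by simp [hμ₂, Mem.setVar]) (by simp [hμ₂, hμ₁, Mem.setVar]))
    refine (Ens.loop_pos ?_ (Ens.set (Ens.set (t := 3 * j + 1) (c := [repsLoop c]) ?_))).mono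
      le_rfl ?_ fun _ h' => h'
    · simp only [Test.holds, Arith.eval, hdim, hn]
      exact (Nat.lt_clog_iff_pow_lt (by norm_num)).1 (by omega)
    · have e : (μ.setVar .dim (Arith.eval μ (.plus (.var .dim) (.var .dim)))) = μ₁ := by
        simp only [Arith.eval, hdim, hμ₁, hs, pow_succ, mul_two]
      have e' : μ₁.setVar .reps (Arith.eval μ₁ (.plus (.var .reps) (.lit c))) = μ₂ := by
        simp only [Arith.eval, hμ₂]
        congr 1
        simp [hμ₁, Mem.setVar, hreps, hs]
        ring
      rw [e, e']
      exact this.mono le_rfl le_rfl fun _ h' => ⟨hag.trans h'.1, h'.2⟩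
    · push_cast
      linarith

/-- The loop that sets all layer numbers to `∞`. -/
def clearLoop : Cmd :=
  .loop (.lt (.var .i) (.var .size)) [.put .lay (.var .i) (.var .size), incr .i]

theorem ens_clearLoop (hn : μ.vars .size = n) (j : ℕ) (hj : j ≤ n) (hi : μ.vars .i = n - j)
    (hlt : ∀ v < n - j, μ.arrs .lay v = n) :
    Ens B good 1 (3 * j + 1) [clearLoop] μ
      fun μ' => (∀ x, x ≠ .i → μ'.vars x = μ.vars x) ∧ (∀ v < n, μ'.arrs .lay v = n) ∧
        μ'.arrs .lay n = μ.arrs .lay n := by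
  induction j generalizing μ with
  | zero =>
    exact (Ens.loop_neg (by simp [Test.holds, Arith.eval, hi, hn])
      (Ens.nil ⟨fun _ _ => rfl, hlt, rfl⟩)).mono le_rfl (by simp) fun _ h' => h'
  | succ j ih =>
    set μ₁ := (μ.setArr .lay (n - (j + 1)) n).setVar .i (n - j) with hμ₁
    have hl : μ₁.arrs .lay = Function.update (μ.arrs .lay) (n - (j + 1)) n := by
      simp [hμ₁, Mem.setVar, Mem.setArr]
    have := ih (μ := μ₁) (by simpa [hμ₁, Mem.setVar, Mem.setArr] using hn) (by omega) (by simp [hμ₁])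
      (fun v hv => by
        rw [hl]
        rcases eq_or_ne v (n - (j + 1)) with rfl | h
        · simp
        · rw [Function.update_of_ne h]; exact hlt v (by omega))
    refine (Ens.loop_pos ?_ (Ens.put (Ens.set (t := 3 * j + 1) (c := [clearLoop]) ?_))).mono
      le_rfl ?_ fun _ h' => h'
    · simp only [Test.holds, Arith.eval, hi, hn]
      omega
    · have e : Mem.setVar (μ.setArr .lay (Arith.eval μ (.var .i)) (Arith.eval μ (.var .size))) .i
          (Arith.eval (μ.setArr .lay (Arith.eval μ (.var .i)) (Arith.eval μ (.var .size)))
            (.plus (.var .i) (.lit 1))) = μ₁ := by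
        simp only [Arith.eval, hi, hn, Mem.setArr, hμ₁]
        congr 1
        omega
      rw [e]
      refine this.mono le_rfl le_rfl fun μ' h' => ⟨fun x hx => ?_, h'.2.1, ?_⟩
      · rw [h'.1 x hx]
        simp [hμ₁, Mem.setVar, Mem.setArr, hx]
      · rw [h'.2.2, hl, Function.update_of_ne (by omega)]
    · push_cast
      linarith

/-- The last part of the initialization, followed by the search proper. -/
def searchFromSrc (M : Model) : List Cmd :=
  [.put .lay (.var .src) (.lit 0), .put .queue (.lit 0) (.var .src), .set .head (.lit 0),
    .set .tail (.lit 1), queueLoop M]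

theorem bfs_eq (M : Model) (c : ℕ) : bfs M c =
    .set .reps (.lit c) :: .set .dim (.lit 1) :: ([repsLoop c] ++ (.set .i (.lit 0) ::
      ([clearLoop] ++ searchFromSrc M))) := rfl

theorem ens_searchFromSrc (hP : Presents M B G) {R : ℕ} (hR : 1 ≤ R) (hsize : μ.vars .size = n)
    (hsrc : μ.vars .src = a) (hreps : μ.vars .reps = R) (hlay : ∀ v < n, μ.arrs .lay v = n)
    (hn : μ.arrs .lay n = 0) :
    Ens B good (searchBound R ^ n)
      (300 * R * √((∑ x : Fin n, (searchSize M B n x : ℝ)) * (2 * n)) + 5)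
      (searchFromSrc M) μ fun μ' => IsLayering G a (storedLayers n μ') := by
  have hδ := searchBound_nonneg R
  unfold searchFromSrc
  refine (Ens.put (Ens.put (Ens.set (Ens.set ((ens_queueLoop (a := a) (h := 0) (t := 1) hP hR n
    ⟨?_, ?_, ?_, ?_, ?_⟩ rfl ∅ (by simp)).mono (pow_le_pow_of_le_one hδ (searchBound_le_one R)
      (Nat.sub_le n 1)) le_rfl fun _ h => h))))).mono le_rfl ?_ fun _ h => h
  · refine Inv.init (fun v hv hva => ?_) ?_ ?_ ?_
    · simp [Mem.setVar, Mem.setArr, Arith.eval, hsrc, Function.update_of_ne hva, hlay v hv]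
    · simp [Mem.setVar, Mem.setArr, Arith.eval, hsrc]
    · have : n ≠ a := a.2.ne'
      simp [Mem.setVar, Mem.setArr, Arith.eval, hsrc, Function.update_of_ne this, hn]
    · simp [Mem.setVar, Mem.setArr, Arith.eval, hsrc]
  · simpa [Mem.setVar, Mem.setArr] using hsize
  · simpa [Mem.setVar, Mem.setArr] using hreps
  · simp [Mem.setVar, Arith.eval]
  · simp [Arith.eval]
  · have hA : 0 ≤ ∑ x : Fin n, (searchSize M B n x : ℝ) :=
      Finset.sum_nonneg fun _ _ => by positivity
    have := mul_le_mul_of_nonneg_left (Real.sqrt_le_sqrt (mul_le_mul_of_nonneg_left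
      (show ((n : ℝ) - (1 : ℕ)) + (n - (0 : ℕ)) ≤ 2 * n by push_cast; linarith) hA))
      (show (0 : ℝ) ≤ 300 * R by positivity)
    rw [Finset.compl_empty]
    linarith

theorem ens_bfs (hP : Presents M B G) {c R : ℕ} (hc : 1 ≤ c) (hR : R = c * (1 + Nat.clog 2 n)) :
    Ens B good (searchBound R ^ n)
      (6 * n + 11 + 300 * R * √((∑ x : Fin n, (searchSize M B n x : ℝ)) * (2 * n)))
      (bfs M c) (initMem n a) fun μ' => IsLayering G a (storedLayers n μ') := by
  have hδ : 0 ≤ searchBound R ^ n := pow_nonneg (searchBound_nonneg R) _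
  have hR1 : 1 ≤ R := by rw [hR]; exact Nat.mul_pos hc (by omega)
  set X : ℝ := 300 * R * √((∑ x : Fin n, (searchSize M B n x : ℝ)) * (2 * n)) with hX
  have hX0 : 0 ≤ X := by positivity
  set μ₁ := ((initMem n a).setVar .reps c).setVar .dim 1 with hμ₁
  have hag₁ : Agree [.size, .src] (initMem n a) μ₁ :=
    (Agree.refl.setVar (by decide) _).setVar (by decide) _
  have step₁ := ens_repsLoop (B := B) (good := good) (μ := μ₁) (n := n) (c := c)
    (hag₁.2 .size (by decide)) (Nat.clog 2 n) le_rfl (by simp [hμ₁, Mem.setVar])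
    (by simp [hμ₁])
  rw [bfs_eq]
  refine (Ens.set (Ens.set (Ens.seq_one step₁ (δ := searchBound R ^ n)
    (t' := 3 * n + 1 + (X + 5) + 1) (fun μ₂ h₂ => ?_) (by positivity) hδ))).mono le_rfl ?_
    fun _ h => h
  · have hag₂ := hag₁.trans h₂.1
    refine Ens.set (Ens.seq_one (ens_clearLoop (n := n) ?_ n le_rfl ?_ ?_) (fun μ₃ h₃ => ?_)
      (by positivity) hδ)
    · simpa [Mem.setVar, initMem] using hag₂.2 .size (by decide)
    · simp [Arith.eval]
    · simp
    · obtain ⟨h1, h2, h3⟩ := h₃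
      refine ens_searchFromSrc hP hR1 ?_ ?_ ?_ h2 ?_
      · rw [h1 _ (by decide)]
        simpa [Mem.setVar, initMem] using hag₂.2 .size (by decide)
      · rw [h1 _ (by decide)]
        simpa [Mem.setVar, initMem] using hag₂.2 .src (by decide)
      · rw [h1 _ (by decide), hR]
        simpa [Mem.setVar] using h₂.2
      · rw [h3, Mem.setVar_arrs, hag₂.1]
        rfl
  · have : (Nat.clog 2 n : ℝ) ≤ n := by
      exact_mod_cast Nat.clog_le_of_le_pow Nat.lt_two_pow_self.le
    linarith

end Bfs

/-! ### Estimates -/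

theorem two_pow_clog_le (d : ℕ) : 2 ^ Nat.clog 2 d ≤ 2 * d + 1 := by
  rcases Nat.lt_or_ge d 2 with hd | hd
  · interval_cases d <;> simp
  · have h1 : 0 < Nat.clog 2 d := Nat.clog_pos (by norm_num) hd
    have h2 : 2 ^ (Nat.clog 2 d - 1) < d := Nat.pow_pred_clog_lt_self (by norm_num) hd
    obtain ⟨k, hk⟩ : ∃ k, Nat.clog 2 d = k + 1 := ⟨_, (Nat.sub_add_cancel h1).symm⟩
    rw [hk, Nat.add_sub_cancel] at h2
    rw [hk, pow_succ]
    omega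

theorem one_add_clog_le {n : ℕ} (hn : 2 ≤ n) : (1 : ℝ) + Nat.clog 2 n ≤ 5 * Real.log n := by
  have hn' : (2 : ℝ) ≤ n := by exact_mod_cast hn
  have h2 := Real.log_two_gt_d9
  have hl : Real.log 2 ≤ Real.log n := Real.log_le_log (by norm_num) hn'
  have hk : Nat.clog 2 n * Real.log 2 ≤ 2 * Real.log n := by
    have h3 : (2 : ℕ) ^ Nat.clog 2 n ≤ n ^ 2 := by
      obtain ⟨k, hk⟩ : ∃ k, Nat.clog 2 n = k + 1 :=
        ⟨_, (Nat.sub_add_cancel (Nat.clog_pos (by norm_num) hn)).symm⟩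
      have := Nat.pow_pred_clog_lt_self (b := 2) (by norm_num) hn
      rw [hk, Nat.pred_eq_sub_one, Nat.add_sub_cancel] at this
      rw [hk, pow_succ]
      nlinarith
    have h4 : (2 : ℝ) ^ Nat.clog 2 n ≤ n ^ 2 := by exact_mod_cast h3
    have := Real.log_le_log (by positivity) h4
    rwa [Real.log_pow, Real.log_pow] at this
  have : (0 : ℝ) ≤ Nat.clog 2 n := by positivity
  nlinarith

/-- With `5 (1 + ⌈log₂ n⌉)` runs in each stage, all of the at most `n` searches with solutions succeed
with probability at least `1 - 1 / n`. -/
theorem one_sub_le_searchBound_pow {n : ℕ} (hn : 1 ≤ n) :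
    1 - 1 / (n : ℝ) ≤ searchBound (5 * (1 + Nat.clog 2 n)) ^ n := by
  have hn' : (0 : ℝ) < n := by exact_mod_cast hn
  set ε : ℝ := (3 / 4) ^ (5 * (1 + Nat.clog 2 n)) with hε
  have h1 : ε ≤ 1 / (n : ℝ) ^ 2 := by
    have h2 : (n : ℝ) ≤ 2 ^ Nat.clog 2 n := by exact_mod_cast Nat.le_pow_clog (by norm_num) n
    calc ε = ((3 / 4) ^ 5) ^ (1 + Nat.clog 2 n) := by rw [hε, pow_mul]
      _ ≤ (1 / 4) ^ (1 + Nat.clog 2 n) := pow_le_pow_left₀ (by norm_num) (by norm_num) _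
      _ ≤ (1 / 4) ^ Nat.clog 2 n := pow_le_pow_of_le_one (by norm_num) (by norm_num) (by omega)
      _ = 1 / (2 ^ Nat.clog 2 n) ^ 2 := by
        rw [← pow_mul, mul_comm, pow_mul, one_div_pow]; norm_num
      _ ≤ 1 / (n : ℝ) ^ 2 := one_div_le_one_div_of_le (by positivity) (pow_le_pow_left₀ hn'.le h2 2)
  have h3 : ε ≤ 1 := pow_le_one₀ (by norm_num) (by norm_num)
  have h4 := one_add_mul_le_pow (show (-2 : ℝ) ≤ -ε by linarith) n
  rw [searchBound, ← hε, sub_eq_add_neg 1 ε]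
  refine le_trans ?_ h4
  have h5 : n * ε ≤ n * (1 / (n : ℝ) ^ 2) := mul_le_mul_of_nonneg_left h1 hn'.le
  have h6 : n * (1 / (n : ℝ) ^ 2) = 1 / n := by field_simp
  linarith

theorem le_successProb {n : ℕ} {G : Digraph (Fin n)} {a : Fin n} {M : Model} {B : BlackBox}
    (hP : Presents M B G) (hn : 2 ≤ n) {Y : ℝ} (hY : n ≤ 2 * Y)
    (hA : √((∑ x : Fin n, (searchSize M B n x : ℝ)) * (2 * n)) ≤ 3 * Y) :
    1 - 1 / (n : ℝ) ≤ successProb M 5 B G a ⌊30000 * Y * Real.log n⌋₊ := by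
  have hn' : (2 : ℝ) ≤ n := by exact_mod_cast hn
  have h := (ens_bfs (a := a) (good := fun μ => IsLayering G a (storedLayers n μ)) hP
    (c := 5) (by norm_num) rfl).2 [] 0 1 le_rfl zero_le_one fun μ' h' => by
      classical
      rw [prob, haltProb_nil, if_pos h']
      simp [initState, QState.normSq]
  rw [mul_one, List.append_nil, zero_add] at h
  refine ((one_sub_le_searchBound_pow (by omega)).trans h).trans (prob_mono ?_ _ _)
  have hl : (1 : ℝ) / 2 ≤ Real.log n := by
    have := Real.log_two_gt_d9
    have := Real.log_le_log (by norm_num) hn'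
    linarith
  have hk := one_add_clog_le hn
  have hY0 : 1 ≤ Y := by linarith
  have h1 := mul_le_mul hk hA (by positivity) (by linarith)
  have h2 : Y * (1 / 2) ≤ Y * Real.log n := mul_le_mul_of_nonneg_left hl (by linarith)
  push_cast
  nlinarith

theorem card_le_edgeCount_add_one {n : ℕ} {G : Digraph (Fin n)} (hG : IsConnected G) :
    n ≤ edgeCount G + 1 := by
  have h1 := hG.card_vert_le_card_edgeSet_add_one
  rw [Nat.card_eq_fintype_card, Fintype.card_fin, Nat.card_coe_set_eq] at h1
  refine h1.trans (Nat.add_le_add_right ?_ 1)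
  refine le_trans (Set.ncard_le_ncard (t := (fun p : Fin n × Fin n => s(p.1, p.2)) ''
    {p | G.Adj p.1 p.2}) (fun e he => ?_) (Set.toFinite _)) (Set.ncard_image_le (Set.toFinite _))
  induction e with
  | _ v w =>
    rw [SimpleGraph.mem_edgeSet, SimpleGraph.fromRel_adj] at he
    rcases he.2 with h | h
    · exact ⟨(v, w), h, rfl⟩
    · exact ⟨(w, v), h, Sym2.eq_swap⟩

theorem edgeCount_le_length {n : ℕ} {G : Digraph (Fin n)} {N : Lists n} (h : N.Represents G) :
    edgeCount G ≤ N.length := by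
  have : N.length = (Set.univ : Set (Σ v, Fin (N.deg v))).ncard := by
    rw [Set.ncard_univ, Nat.card_eq_fintype_card, Fintype.card_sigma]
    simp [Lists.length]
  rw [this]
  refine le_trans (Set.ncard_le_ncard (t := (fun p : Σ v, Fin (N.deg v) =>
    (p.1, (N.entry p.1 p.2).getD p.1)) '' Set.univ) (fun p hp => ?_) (Set.toFinite _))
    (Set.ncard_image_le (Set.toFinite _))
  obtain ⟨j, hj⟩ := (h _ _).1 hp
  exact ⟨⟨p.1, j⟩, trivial, by simp [hj]⟩

theorem two_le_of_edge {n : ℕ} {G : Digraph (Fin n)} (hl : ∀ v, ¬G.Adj v v)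
    (he : 1 ≤ edgeCount G) : 2 ≤ n := by
  obtain ⟨⟨v, w⟩, h⟩ := Set.nonempty_of_ncard_ne_zero (Nat.one_le_iff_ne_zero.1 he)
  by_contra hn
  have : v = w := Fin.ext (by omega)
  exact hl v (by simpa [← this] using h)

end QBFS

theorem mainTheorem4 :
    ∃ (c : ℕ) (C : ℝ), 0 < C ∧
      ∀ (n : ℕ) (G : Digraph (Fin n)) (a : Fin n),
        (∀ v, ¬ G.Adj v v) → 1 ≤ QBFS.edgeCount G → QBFS.IsConnected G →
        1 - 1 / (n : ℝ) ≤ QBFS.successProb .adjacency c (QBFS.adjacencyBox G) G a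
            ⌊C * (n : ℝ) ^ (3 / 2 : ℝ) * Real.log n⌋₊ ∧
        ∀ N : QBFS.Lists n, N.Represents G →
          1 - 1 / (n : ℝ) ≤ QBFS.successProb .list c N.box G a
              ⌊C * √((n : ℝ) * N.length) * Real.log n⌋₊ ∧
          (N.length = QBFS.edgeCount G →
            1 - 1 / (n : ℝ) ≤ QBFS.successProb .list c N.box G a
              ⌊C * √((n : ℝ) * QBFS.edgeCount G) * Real.log n⌋₊) := by
  refine ⟨5, 30000, by norm_num, fun n G a hl he hc => ?_⟩
  have hn := QBFS.two_le_of_edge hl he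
  have hn' : (2 : ℝ) ≤ n := by exact_mod_cast hn
  constructor
  · have hsq : ((n : ℝ) ^ (3 / 2 : ℝ)) ^ 2 = n ^ 3 := by
      rw [← Real.rpow_natCast, ← Real.rpow_mul (by positivity)]
      norm_num
    have hY : 0 ≤ (n : ℝ) ^ (3 / 2 : ℝ) := by positivity
    refine QBFS.le_successProb (QBFS.presents_adjacencyBox G) hn ?_ ?_
    · refine le_of_sq_le_sq ?_ (by positivity)
      rw [mul_pow, hsq]
      nlinarith [pow_pos (show (0 : ℝ) < n by linarith) 2]
    · have hs : ∑ x : Fin n, (QBFS.searchSize .adjacency (QBFS.adjacencyBox G) n x : ℝ) ≤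
          n * (3 * n) := by
        refine (Finset.sum_le_card_nsmul _ _ (3 * n : ℝ) fun x _ => ?_).trans (by simp)
        have := QBFS.two_pow_clog_le n
        have : 2 ^ Nat.clog 2 n ≤ 3 * n := by omega
        exact_mod_cast this
      refine Real.sqrt_le_iff.2 ⟨by positivity, ?_⟩
      rw [mul_pow, hsq]
      nlinarith [pow_pos (show (0 : ℝ) < n by linarith) 3]
  · intro N hN
    have main : 1 - 1 / (n : ℝ) ≤ QBFS.successProb .list 5 N.box G a
        ⌊30000 * √((n : ℝ) * N.length) * Real.log n⌋₊ := by
      have hL : n ≤ N.length + 1 :=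
        (QBFS.card_le_edgeCount_add_one hc).trans
          (Nat.add_le_add_right (QBFS.edgeCount_le_length hN) 1)
      have hL' : (n : ℝ) ≤ 2 * N.length := by exact_mod_cast (by omega : n ≤ 2 * N.length)
      refine QBFS.le_successProb (QBFS.presents_box hN) hn ?_ ?_
      · refine le_of_sq_le_sq ?_ (by positivity)
        rw [mul_pow, Real.sq_sqrt (by positivity)]
        nlinarith
      · have hs : ∑ x : Fin n, (QBFS.searchSize .list N.box n x : ℝ) ≤ 2 * N.length + n := by
          have : ∀ x ∈ (Finset.univ : Finset (Fin n)),
              (QBFS.searchSize .list N.box n x : ℝ) ≤ 2 * N.deg x + 1 := by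
            intro x _
            have h := QBFS.two_pow_clog_le (N.deg x)
            have e : QBFS.rowLen .list N.box n x = N.deg x := by
              simp [QBFS.rowLen, QBFS.Lists.box]
            rw [QBFS.searchSize, e]
            exact_mod_cast h
          refine (Finset.sum_le_sum this).trans (le_of_eq ?_)
          rw [Finset.sum_add_distrib, ← Finset.mul_sum, QBFS.Lists.length]
          simp
        refine Real.sqrt_le_iff.2 ⟨by positivity, ?_⟩
        rw [mul_pow, Real.sq_sqrt (by positivity)]
        nlinarith
    exact ⟨main, fun h => by rw [← h]; exact main⟩
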